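/- Let $\mathbb{K}$ be a field and let $\Delta$ be a simplicial complex on a finite vertex set, i.e. a family of subsets of that set (the faces) that is closed under taking subsets and contains $\emptyset$. Put $\dim\Delta=\max_{\sigma\in\Delta}|\sigma|-1$, and for $\sigma\in\Delta$ let $\operatorname{link}_\Delta\sigma=\{\tau\in\Delta:\sigma\cap\tau=\emptyset,\ \sigma\cup\tau\in\Delta\}$. Write $\widetilde H_i(-)$ for reduced simplicial homology with coefficients in $\mathbb{K}$; in particular $\widetilde H_{-1}(\{\emptyset\})=\mathbb{K}$. The barycentric subdivision $\mathcal{B}(\Delta)$ is the complex whose vertices $u_\sigma$ correspond to the nonempty faces $\sigma$ of $\Delta$ and whose faces are the sets $\{u_{\sigma_1},\dots,u_{\sigma_r}\}$ with $\sigma_1\subset\dots\subset\sigma_r$ (including the empty set). A complex $\Delta$ is called PR if for every $i$ and all faces $\sigma,\tau\in\Delta$ with $\widetilde H_i(\operatorname{link}_\Delta\sigma)\neq 0\neq\widetilde H_i(\operatorname{link}_\Delta\tau)$ we have $|\sigma|=|\tau|$. If $\Delta$ is PR, let $p$ be the largest index such that $\widetilde H_{p-1}(\operatorname{link}_\Delta\sigma)\ne0$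 for some face $\sigma$; for $0\le i\le p$ let $s_i$ be the size of the faces $\sigma$ with $\widetilde H_{i-1}(\operatorname{link}_\Delta\sigma)\neq0$, and for $1\le i\le p$ let $d_i=s_{i-1}-s_i$; the sequence $(d_p,\dots,d_1)$ is the degree type of $\Delta$. A complex $\Delta$ is called Cohen–Macaulay if $\widetilde H_i(\operatorname{link}_\Delta\sigma)=0$ for every face $\sigma\in\Delta$ and every $i\neq\dim\Delta-|\sigma|$. Then the following are equivalent: 1. $\mathcal{B}(\Delta)$ is PR; 2. $\mathcal{B}(\Delta)$ is Cohen–Macaulay; 3. $\mathcal{B}(\Delta)$ is PR with degree type $(1,\dots,1)$ (of some length $p\ge 0$); 4. $\Delta$ is Cohen–Macaulay; 5. $\Delta$ is PR with degree type $(1,\dots,1)$ (of some length $p\ge 0$). -/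

import Mathlib

/-! Simplicial complexes are Mathlib's `PreAbstractSimplicialComplex V`: down-closed families of
nonempty finite subsets of `V` (elements of `V` need not be vertices). Mathlib leaves the empty face
implicit; `allFaces` puts it back, so every complex here contains the face `∅`. -/

namespace PreAbstractSimplicialComplex

variable {V : Type*}

/-- All faces of `Δ`, including the empty face. -/
def allFaces (Δ : PreAbstractSimplicialComplex V) : Set (Finset V) :=
  insert ∅ Δ.faces

/-- The dimension of `Δ`: the largest cardinality of a face, minus one
(so the complex `{∅}` has dimension `-1`). -/
noncomputable def dim (Δ : PreAbstractSimplicialComplex V) : ℤ :=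
  ((sSup (Finset.card '' Δ.allFaces) : ℕ) : ℤ) - 1

/-- The link of `σ` in `Δ`: its faces are the `τ` disjoint from `σ` such that
`σ ∪ τ` is a face of `Δ`. -/
def link [DecidableEq V] (Δ : PreAbstractSimplicialComplex V) (σ : Finset V) :
    PreAbstractSimplicialComplex V where
  faces := {τ | τ.Nonempty ∧ Disjoint σ τ ∧ σ ∪ τ ∈ Δ.faces}
  isRelLowerSet_faces := by
    rintro τ ⟨hne, hdisj, hmem⟩
    refine ⟨hne, fun ρ hρ hρne => ⟨hρne, hdisj.mono_right hρ, ?_⟩⟩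
    exact (Δ.isRelLowerSet_faces hmem).2 (Finset.union_subset_union_right hρ)
      (hρne.mono Finset.subset_union_right)

/-- The barycentric subdivision of `Δ`: its vertices are the nonempty faces of `Δ`, and its faces
are the finite sets of such faces which are totally ordered by inclusion. -/
def barycentricSubdivision (Δ : PreAbstractSimplicialComplex V) :
    PreAbstractSimplicialComplex {σ : Finset V // σ ∈ Δ.faces} where
  faces := {s | s.Nonempty ∧ IsChain (fun σ τ => σ.1 ⊆ τ.1) (s : Set {σ // σ ∈ Δ.faces})}
  isRelLowerSet_faces := by
    rintro s ⟨hne, hs⟩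
    exact ⟨hne, fun t ht htne => ⟨htne, hs.mono (Finset.coe_subset.2 ht)⟩⟩

section Homology

/-- The ordered simplices of `Δ` with `k` entries: `k`-tuples of vertices (repetitions allowed) all
lying in a common face of `Δ`. For `k = 0` there is exactly one, spanning the empty face. -/
def OrderedSimplex (Δ : PreAbstractSimplicialComplex V) (k : ℕ) : Type _ :=
  {t : Fin k → V // ∃ σ ∈ Δ.allFaces, ∀ j, t j ∈ σ}

/-- The ordered simplex obtained by omitting the `j`-th entry. -/
def OrderedSimplex.dropEntry {Δ : PreAbstractSimplicialComplex V} {k : ℕ}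
    (t : Δ.OrderedSimplex (k + 1)) (j : Fin (k + 1)) : Δ.OrderedSimplex k :=
  ⟨fun l => t.1 (j.succAbove l), t.2.imp fun _ h => ⟨h.1, fun l => h.2 (j.succAbove l)⟩⟩

variable (𝕜 : Type*) [Field 𝕜] (Δ : PreAbstractSimplicialComplex V)

/-- The group of ordered simplicial chains of dimension `k - 1` with coefficients in `𝕜`. -/
abbrev Chain (k : ℕ) : Type _ := Δ.OrderedSimplex k →₀ 𝕜

/-- The boundary map of the augmented ordered simplicial chain complex,
`∂ (v₀, …, v_k) = ∑ j, (-1) ^ j (v₀, …, v_{j-1}, v_{j+1}, …, v_k)`. -/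
noncomputable def boundary (k : ℕ) : Δ.Chain 𝕜 (k + 1) →ₗ[𝕜] Δ.Chain 𝕜 k :=
  Finsupp.lsum 𝕜 fun t =>
    ∑ j : Fin (k + 1), ((-1 : 𝕜) ^ (j : ℕ)) • Finsupp.lsingle (t.dropEntry j)

/-- The cycles of dimension `k - 1`; in dimension `-1` every chain is a cycle. -/
noncomputable def cycles : (k : ℕ) → Submodule 𝕜 (Δ.Chain 𝕜 k)
  | 0 => ⊤
  | k + 1 => LinearMap.ker (Δ.boundary 𝕜 k)

/-- The reduced simplicial homology of `Δ` with coefficients in `𝕜`, indexed by the number of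
entries: `ReducedHomology 𝕜 Δ k` is `H̃_{k-1}(Δ; 𝕜)`, the space of cycles modulo boundaries,
realized as the image of the cycles in the quotient of the chains by the boundaries. -/
abbrev ReducedHomology (k : ℕ) : Type _ :=
  ↥((Δ.cycles 𝕜 k).map (LinearMap.range (Δ.boundary 𝕜 k)).mkQ)

/-- `H̃_i(Δ; 𝕜) ≠ 0`, for an arbitrary integer `i` (the groups vanish for `i < -1`). -/
def HasReducedHomology (i : ℤ) : Prop :=
  ∃ k : ℕ, (k : ℤ) = i + 1 ∧ Nontrivial (Δ.ReducedHomology 𝕜 k)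

end Homology

variable [DecidableEq V] (𝕜 : Type*) [Field 𝕜] (Δ : PreAbstractSimplicialComplex V)

/-- `Δ` is PR over `𝕜`: faces whose links have nonzero reduced homology in the same degree have
the same size. -/
def IsPR : Prop :=
  ∀ (i : ℤ), ∀ σ ∈ Δ.allFaces, ∀ τ ∈ Δ.allFaces,
    (Δ.link σ).HasReducedHomology 𝕜 i → (Δ.link τ).HasReducedHomology 𝕜 i → σ.card = τ.card

/-- `Δ` is PR over `𝕜` with degree type `(d_p, …, d_1)`, where the entry `d_{i+1}` is `d i`:
`p` is the largest index such that some face has a link with nonzero `H̃_{p-1}`, `s i` is the size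
of the faces whose links have nonzero `H̃_{i-1}` for `0 ≤ i ≤ p`, and `d_{i+1} = s i - s (i+1)`. -/
def IsPRWithDegreeType (p : ℕ) (d : Fin p → ℤ) : Prop :=
  Δ.IsPR 𝕜 ∧
  (∀ σ ∈ Δ.allFaces, ∀ i : ℤ, (Δ.link σ).HasReducedHomology 𝕜 i → i ≤ (p : ℤ) - 1) ∧
  ∃ s : ℕ → ℕ,
    (∀ i : ℕ, i ≤ p →
      ∃ σ ∈ Δ.allFaces, σ.card = s i ∧ (Δ.link σ).HasReducedHomology 𝕜 ((i : ℤ) - 1)) ∧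
    ∀ i : Fin p, d i = (s (i : ℕ) : ℤ) - (s ((i : ℕ) + 1) : ℤ)

/-- `Δ` is PR over `𝕜` with degree type `(1, …, 1)`, of some length `p ≥ 0`. -/
def IsPRWithDegreeTypeOnes : Prop :=
  ∃ p : ℕ, Δ.IsPRWithDegreeType 𝕜 p fun _ => 1

/-- `Δ` is a Cohen–Macaulay complex over `𝕜`: for every face `σ`, the reduced homology of its link
vanishes in all degrees other than `dim Δ - |σ|`. -/
def IsCohenMacaulay : Prop :=
  ∀ σ ∈ Δ.allFaces, ∀ i : ℤ, i ≠ Δ.dim - σ.card → ¬ (Δ.link σ).HasReducedHomology 𝕜 i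

end PreAbstractSimplicialComplex

/-! Ordered chains supported on a lower set of finite sets, and Mayer–Vietoris for them. -/

namespace OrderedChains

variable {V W : Type*} (𝕜 : Type*) [Field 𝕜]

/-! Let D = dim Δ + 1. The crux is the homology of links in the subdivision. If C is a nonempty
chain of faces with top member σ and n = |σ| - |C|, then the link of C has the homology of the
n-fold suspension of link σ (`acyclicAt_link_chain`). The link of the empty chain has the homology
of Δ itself (`acyclicAt_link_empty`).

From this, Cohen–Macaulayness of Δ passes to the subdivision by adding sizes and degrees.
Conversely, suppose the subdivision is PR and let F be a face of size D. Its link is {∅}, so chains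
of size D - k with top F have nonzero homology in degree k - 1, for every k < D. These fix the size
that PR prescribes in each such degree. If link σ has homology in degree k - 1 and σ is nonempty,
the one-element chain {σ} has homology in degree k + |σ| - 2, and comparison gives k + |σ| = D.

For any complex, Cohen–Macaulay is equivalent to PR with degree type (1, …, 1). A face of size D
gives s_0 = D, so unit steps force s_i = D - i. In the other direction, top homology of a link
descends to the link of some vertex (`exists_not_acyclicAt_link`), so no degree is skipped.

The suspension statement is proved by refining C one vertex at a time. If C skips a size, a vertex x
of its link can be chosen with acyclic deletion (`exists_refinement`), and Mayer–Vietoris identifies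
link C with a suspension of the link of C ∪ {x}. For a saturated chain the link consists of the
chains above σ, which are compared with link σ through a mapping cylinder
(`acyclicAt_upperChains_iff`).

Only vanishing of homology is tracked. `AcyclicAt 𝕜 k` concerns chains with k entries, that is
H̃_{k-1}. All chains live in one ambient module, with subcomplexes given by supports, so that unions
and intersections can be formed directly. -/

/-- The boundary map on all ordered chains with vertices in `V`. -/
noncomputable def bdry (k : ℕ) : ((Fin (k + 1) → V) →₀ 𝕜) →ₗ[𝕜] ((Fin k → V) →₀ 𝕜) :=
  Finsupp.lsum 𝕜 fun t =>
    ∑ j : Fin (k + 1), ((-1 : 𝕜) ^ (j : ℕ)) • Finsupp.lsingle (fun l => t (j.succAbove l))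

/-- The ordered simplices with `k` entries of a family of finite sets. -/
def simplices (K : Set (Finset V)) (k : ℕ) : Set (Fin k → V) :=
  {t | ∃ σ ∈ K, ∀ j, t j ∈ σ}

/-- The chains supported on the ordered simplices of a family of finite sets. -/
noncomputable def chains (K : Set (Finset V)) (k : ℕ) : Submodule 𝕜 ((Fin k → V) →₀ 𝕜) :=
  Finsupp.supported 𝕜 𝕜 (simplices K k)

/-- A chain is a cycle; every chain with no entries is one. -/
def IsCycle : (k : ℕ) → ((Fin k → V) →₀ 𝕜) → Prop
  | 0, _ => True
  | k + 1, z => bdry 𝕜 k z = 0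

/-- Every cycle of `K` with `k` entries is a boundary of a chain of `K`. -/
def AcyclicAt (k : ℕ) (K : Set (Finset V)) : Prop :=
  ∀ z ∈ chains 𝕜 K k, IsCycle 𝕜 k z → ∃ w ∈ chains 𝕜 K (k + 1), bdry 𝕜 k w = z

/-- Prepending a vertex to all simplices of a chain. -/
noncomputable def prepend (u : V) (k : ℕ) :
    ((Fin k → V) →₀ 𝕜) →ₗ[𝕜] ((Fin (k + 1) → V) →₀ 𝕜) :=
  Finsupp.lmapDomain 𝕜 𝕜 (fun t => (Fin.cons u t : Fin (k + 1) → V))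

variable {𝕜}

theorem bdry_single (k : ℕ) (t : Fin (k + 1) → V) (a : 𝕜) :
    bdry 𝕜 k (Finsupp.single t a) =
      ∑ j : Fin (k + 1), (-1 : 𝕜) ^ (j : ℕ) • Finsupp.single (fun l => t (j.succAbove l)) a := by
  simp [bdry]

theorem prepend_single (u : V) (k : ℕ) (t : Fin k → V) (a : 𝕜) :
    prepend 𝕜 u k (Finsupp.single t a) = Finsupp.single (Fin.cons u t : Fin (k + 1) → V) a := by
  simp [prepend]

theorem bdry_prepend_zero (u : V) (z : (Fin 0 → V) →₀ 𝕜) : bdry 𝕜 0 (prepend 𝕜 u 0 z) = z := by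
  induction z using Finsupp.induction_linear with
  | zero => simp
  | add f g hf hg => simp [hf, hg]
  | single t a =>
    rw [prepend_single, bdry_single]
    rw [Fin.sum_univ_succ, Fin.sum_univ_zero, add_zero, Fin.val_zero, pow_zero, one_smul]
    congr 1

/-- Prepending u is a chain homotopy between the identity and zero. The formula serves both for ∂∂ =
0 and for the acyclicity of cones. -/
theorem bdry_prepend_succ (u : V) (k : ℕ) (z : (Fin (k + 1) → V) →₀ 𝕜) :
    bdry 𝕜 (k + 1) (prepend 𝕜 u (k + 1) z) = z - prepend 𝕜 u k (bdry 𝕜 k z) := by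
  induction z using Finsupp.induction_linear with
  | zero => simp
  | add f g hf hg => simp only [map_add, hf, hg]; abel
  | single t a =>
    rw [prepend_single, bdry_single, Fin.sum_univ_succ, bdry_single, map_sum, sub_eq_add_neg,
      ← Finset.sum_neg_distrib]
    congr 1
    · simp
    · refine Finset.sum_congr rfl fun j _ => ?_
      rw [map_smul, prepend_single, Fin.val_succ, pow_succ, mul_neg_one, neg_smul]
      congr 3
      funext l
      refine Fin.cases ?_ (fun l => ?_) l
      · simp
      · simp

/-- Every nonempty tuple is its head prepended to its tail, so the homotopy formula reduces the
claim to lower degree without any cancellation of signs. -/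
theorem bdry_bdry (k : ℕ) (z : (Fin (k + 2) → V) →₀ 𝕜) : bdry 𝕜 k (bdry 𝕜 (k + 1) z) = 0 := by
  induction k with
  | zero =>
    induction z using Finsupp.induction_linear with
    | zero => simp
    | add f g hf hg => simp [hf, hg]
    | single t a =>
      rw [← Fin.cons_self_tail t, ← prepend_single, bdry_prepend_succ, map_sub, bdry_prepend_zero,
        sub_self]
  | succ k ih =>
    induction z using Finsupp.induction_linear with
    | zero => simp
    | add f g hf hg => simp [hf, hg]
    | single t a =>
      rw [← Fin.cons_self_tail t, ← prepend_single, bdry_prepend_succ, map_sub, bdry_prepend_succ,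
        ih, map_zero, sub_zero, sub_self]

theorem isCycle_bdry (k : ℕ) (z : (Fin (k + 1) → V) →₀ 𝕜) : IsCycle 𝕜 k (bdry 𝕜 k z) := by
  cases k with
  | zero => trivial
  | succ k => exact bdry_bdry k z

theorem single_mem_chains {K : Set (Finset V)} {k : ℕ} {t : Fin k → V} (ht : t ∈ simplices K k)
    (a : 𝕜) : Finsupp.single t a ∈ chains 𝕜 K k :=
  Finsupp.single_mem_supported 𝕜 a ht

theorem map_chains_le {K : Set (Finset V)} {k : ℕ} {M : Type*} [AddCommGroup M] [Module 𝕜 M]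
    (f : ((Fin k → V) →₀ 𝕜) →ₗ[𝕜] M) (N : Submodule 𝕜 M)
    (h : ∀ t ∈ simplices K k, f (Finsupp.single t 1) ∈ N)
    {z : (Fin k → V) →₀ 𝕜} (hz : z ∈ chains 𝕜 K k) : f z ∈ N := by
  have : chains 𝕜 K k ≤ N.comap f := by
    rw [chains, Finsupp.supported_eq_span_single, Submodule.span_le]
    rintro _ ⟨t, ht, rfl⟩
    exact h t ht
  exact this hz

theorem bdry_mem_chains {K : Set (Finset V)} {k : ℕ} {z : (Fin (k + 1) → V) →₀ 𝕜}
    (hz : z ∈ chains 𝕜 K (k + 1)) : bdry 𝕜 k z ∈ chains 𝕜 K k := by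
  refine map_chains_le _ _ (fun t ⟨σ, hσ, ht⟩ => ?_) hz
  rw [bdry_single]
  exact Submodule.sum_mem _ fun j _ => Submodule.smul_mem _ _
    (single_mem_chains ⟨σ, hσ, fun l => ht _⟩ _)

theorem chains_mono {K L : Set (Finset V)} (h : K ⊆ L) (k : ℕ) : chains 𝕜 K k ≤ chains 𝕜 L k :=
  Finsupp.supported_mono fun _ ⟨σ, hσ, ht⟩ => ⟨σ, h hσ, ht⟩

/-- An ordered simplex of A ∪ B lies in a single face, hence already in A or in B. -/
theorem exists_add_of_mem_chains_union {A B : Set (Finset V)} {k : ℕ} {z : (Fin k → V) →₀ 𝕜}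
    (hz : z ∈ chains 𝕜 (A ∪ B) k) : ∃ a ∈ chains 𝕜 A k, ∃ b ∈ chains 𝕜 B k, a + b = z := by
  have h : simplices (A ∪ B) k = simplices A k ∪ simplices B k := by
    ext t
    constructor
    · rintro ⟨σ, hσ | hσ, ht⟩
      · exact Or.inl ⟨σ, hσ, ht⟩
      · exact Or.inr ⟨σ, hσ, ht⟩
    · rintro (⟨σ, hσ, ht⟩ | ⟨σ, hσ, ht⟩)
      · exact ⟨σ, Or.inl hσ, ht⟩
      · exact ⟨σ, Or.inr hσ, ht⟩
  rw [chains, h, Finsupp.supported_union, Submodule.mem_sup] at hz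
  exact hz

theorem mem_chains_inter {A B : Set (Finset V)} (hA : IsLowerSet A) (hB : IsLowerSet B) {k : ℕ}
    {z : (Fin k → V) →₀ 𝕜} (ha : z ∈ chains 𝕜 A k) (hb : z ∈ chains 𝕜 B k) :
    z ∈ chains 𝕜 (A ∩ B) k := by
  classical
  intro t ht
  obtain ⟨σ, hσ, h⟩ := ha ht
  obtain ⟨τ, hτ, h'⟩ := hb ht
  exact ⟨σ ∩ τ, ⟨hA Finset.inter_subset_left hσ, hB Finset.inter_subset_right hτ⟩,
    fun j => Finset.mem_inter.2 ⟨h j, h' j⟩⟩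

section MayerVietoris

variable {A B : Set (Finset V)}

/-- In the lowest degree every chain is a cycle, so the two summands can be bounded separately and A
∩ B plays no role. -/
theorem AcyclicAt.union_zero (hA : AcyclicAt 𝕜 0 A) (hB : AcyclicAt 𝕜 0 B) :
    AcyclicAt 𝕜 0 (A ∪ B) := by
  intro z hz _
  obtain ⟨a, ha, b, hb, rfl⟩ := exists_add_of_mem_chains_union hz
  obtain ⟨p, hp, rfl⟩ := hA a ha trivial
  obtain ⟨q, hq, rfl⟩ := hB b hb trivial
  exact ⟨p + q, add_mem (chains_mono Set.subset_union_left _ hp)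
    (chains_mono Set.subset_union_right _ hq), map_add _ _ _⟩

/-- Exactness at H(A ∪ B). For a cycle a + b, the chain ∂a = -∂b is a cycle of A ∩ B; a chain c of A
∩ B bounding it corrects both summands to the cycles a - c and b + c. -/
theorem AcyclicAt.union_succ (hlA : IsLowerSet A) (hlB : IsLowerSet B) {k : ℕ}
    (hA : AcyclicAt 𝕜 (k + 1) A) (hB : AcyclicAt 𝕜 (k + 1) B) (hI : AcyclicAt 𝕜 k (A ∩ B)) :
    AcyclicAt 𝕜 (k + 1) (A ∪ B) := by
  intro z hz hc
  obtain ⟨a, ha, b, hb, rfl⟩ := exists_add_of_mem_chains_union hz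
  have hab : bdry 𝕜 k a = -bdry 𝕜 k b := by
    rw [IsCycle, map_add] at hc
    exact eq_neg_of_add_eq_zero_left hc
  obtain ⟨c, hc, hca⟩ := hI (bdry 𝕜 k a)
    (mem_chains_inter hlA hlB (bdry_mem_chains ha) (hab ▸ neg_mem (bdry_mem_chains hb)))
    (isCycle_bdry _ _)
  obtain ⟨p, hp, hpa⟩ := hA (a - c) (sub_mem ha (chains_mono Set.inter_subset_left _ hc))
    (by rw [IsCycle, map_sub, hca, sub_self])
  obtain ⟨q, hq, hqb⟩ := hB (b + c) (add_mem hb (chains_mono Set.inter_subset_right _ hc))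
    (by rw [IsCycle, map_add, hca, hab, add_neg_cancel])
  refine ⟨p + q, add_mem (chains_mono Set.subset_union_left _ hp)
    (chains_mono Set.subset_union_right _ hq), ?_⟩
  rw [map_add, hpa, hqb]
  abel

/-- Exactness at H(A) ⊕ H(B), applied to a class (a, 0). -/
theorem AcyclicAt.of_union_left (hlA : IsLowerSet A) (hlB : IsLowerSet B) {k : ℕ}
    (hU : AcyclicAt 𝕜 k (A ∪ B)) (hI : AcyclicAt 𝕜 k (A ∩ B)) : AcyclicAt 𝕜 k A := by
  intro a ha hc
  obtain ⟨w, hw, hwa⟩ := hU a (chains_mono Set.subset_union_left _ ha) hc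
  obtain ⟨p, hp, q, hq, rfl⟩ := exists_add_of_mem_chains_union hw
  have hq' : bdry 𝕜 k q = a - bdry 𝕜 k p := by rw [← hwa, map_add]; abel
  obtain ⟨r, hr, hrq⟩ := hI (bdry 𝕜 k q)
    (mem_chains_inter hlA hlB (hq' ▸ sub_mem ha (bdry_mem_chains hp)) (bdry_mem_chains hq))
    (isCycle_bdry _ _)
  refine ⟨p + r, add_mem hp (chains_mono Set.inter_subset_left _ hr), ?_⟩
  rw [map_add, hrq, ← map_add, hwa]

/-- Exactness at H(A ∩ B): two bounding chains, one in A and one in B, differ by a cycle of A ∪ B.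
-/
theorem AcyclicAt.inter (hlA : IsLowerSet A) (hlB : IsLowerSet B) {k : ℕ}
    (hU : AcyclicAt 𝕜 (k + 1) (A ∪ B)) (hA : AcyclicAt 𝕜 k A) (hB : AcyclicAt 𝕜 k B) :
    AcyclicAt 𝕜 k (A ∩ B) := by
  intro z hz hc
  obtain ⟨a, ha, haz⟩ := hA z (chains_mono Set.inter_subset_left _ hz) hc
  obtain ⟨b, hb, hbz⟩ := hB z (chains_mono Set.inter_subset_right _ hz) hc
  obtain ⟨w, hw, hwab⟩ := hU (a - b) (sub_mem (chains_mono Set.subset_union_left _ ha)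
    (chains_mono Set.subset_union_right _ hb)) (by rw [IsCycle, map_sub, haz, hbz, sub_self])
  obtain ⟨p, hp, q, hq, rfl⟩ := exists_add_of_mem_chains_union hw
  have h : a - bdry 𝕜 (k + 1) p = b + bdry 𝕜 (k + 1) q := by
    rw [map_add] at hwab
    rw [sub_eq_iff_eq_add, add_assoc, add_comm (bdry 𝕜 (k + 1) q), hwab]
    abel
  refine ⟨a - bdry 𝕜 (k + 1) p, mem_chains_inter hlA hlB (sub_mem ha (bdry_mem_chains hp))
    (h ▸ add_mem hb (bdry_mem_chains hq)), ?_⟩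
  rw [map_sub, bdry_bdry, haz, sub_zero]

end MayerVietoris

/-- Prepending the apex preserves the chains of K, so it is a contracting homotopy. -/
theorem acyclicAt_of_cone [DecidableEq V] {K : Set (Finset V)} (u : V)
    (h : ∀ ρ ∈ K, insert u ρ ∈ K) (k : ℕ) : AcyclicAt 𝕜 k K := by
  have hp : ∀ {k : ℕ} {z : (Fin k → V) →₀ 𝕜}, z ∈ chains 𝕜 K k →
      prepend 𝕜 u k z ∈ chains 𝕜 K (k + 1) := by
    intro k z hz
    refine map_chains_le _ _ (fun t ⟨σ, hσ, ht⟩ => ?_) hz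
    rw [prepend_single]
    refine single_mem_chains ⟨_, h σ hσ, fun j => ?_⟩ _
    refine Fin.cases (by simp) (fun j => ?_) j
    simp [ht j]
  intro z hz hc
  refine ⟨prepend 𝕜 u k z, hp hz, ?_⟩
  cases k with
  | zero => exact bdry_prepend_zero u z
  | succ k =>
    rw [bdry_prepend_succ]
    simp only [IsCycle] at hc
    rw [hc, map_zero, sub_zero]

/-- Injective relabelling of the vertices. -/
theorem acyclicAt_image_iff (f : V ↪ W) (K : Set (Finset V)) (k : ℕ) :
    AcyclicAt 𝕜 k (Finset.map f '' K) ↔ AcyclicAt 𝕜 k K := by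
  have hinj : ∀ k : ℕ, Function.Injective (fun t : Fin k → V => (fun j => f (t j) : Fin k → W)) :=
    fun k t s h => funext fun j => f.injective (congrFun h j)
  set F : ∀ k : ℕ, ((Fin k → V) →₀ 𝕜) →ₗ[𝕜] ((Fin k → W) →₀ 𝕜) :=
    fun k => Finsupp.lmapDomain 𝕜 𝕜 (fun t j => f (t j)) with hF
  have hFinj : ∀ k, Function.Injective (F k) := fun k => Finsupp.mapDomain_injective (hinj k)
  have hFs : ∀ k t a, F k (Finsupp.single t a) = Finsupp.single (fun j => f (t j)) a :=
    fun k t a => Finsupp.mapDomain_single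
  have hFb : ∀ k z, bdry 𝕜 k (F (k + 1) z) = F k (bdry 𝕜 k z) := by
    intro k z
    induction z using Finsupp.induction_linear with
    | zero => simp
    | add f g hf hg => simp [hf, hg]
    | single t a =>
      rw [hFs, bdry_single, bdry_single, map_sum]
      exact Finset.sum_congr rfl fun j _ => by rw [map_smul, hFs]
  have hFc : ∀ k z, IsCycle 𝕜 k (F k z) ↔ IsCycle 𝕜 k z := by
    intro k z
    cases k with
    | zero => exact Iff.rfl
    | succ k =>
      simp only [IsCycle]
      rw [hFb, ← map_zero (F k), (hFinj k).eq_iff]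
  have himg : ∀ k, simplices (Finset.map f '' K) k = (fun t j => f (t j)) '' simplices K k := by
    intro k
    ext t
    constructor
    · rintro ⟨_, ⟨σ, hσ, rfl⟩, ht⟩
      choose s hs hst using fun j => Finset.mem_map.1 (ht j)
      exact ⟨s, ⟨σ, hσ, hs⟩, funext hst⟩
    · rintro ⟨s, ⟨σ, hσ, hs⟩, rfl⟩
      exact ⟨_, ⟨σ, hσ, rfl⟩, fun j => Finset.mem_map_of_mem f (hs j)⟩
  have hch : ∀ k, chains 𝕜 (Finset.map f '' K) k = (chains 𝕜 K k).map (F k) := by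
    intro k
    rw [chains, himg, chains, Finsupp.lmapDomain_supported]
  constructor
  · intro h z hz hc
    obtain ⟨w, hw, hwz⟩ := h (F k z) (hch k ▸ Submodule.mem_map_of_mem hz) ((hFc k z).2 hc)
    rw [hch] at hw
    obtain ⟨w, hw, rfl⟩ := hw
    exact ⟨w, hw, hFinj k (by rw [← hFb, hwz])⟩
  · intro h z hz hc
    rw [hch] at hz
    obtain ⟨z, hz, rfl⟩ := hz
    obtain ⟨w, hw, rfl⟩ := h z hz ((hFc k z).1 hc)
    exact ⟨F (k + 1) w, hch (k + 1) ▸ Submodule.mem_map_of_mem hw, hFb _ _⟩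

/-- The comparison with the reduced homology of a simplicial complex. -/
theorem hasReducedHomology_iff (Δ : PreAbstractSimplicialComplex V) (i : ℤ) :
    Δ.HasReducedHomology 𝕜 i ↔ ∃ k : ℕ, (k : ℤ) = i + 1 ∧ ¬ AcyclicAt 𝕜 k Δ.allFaces := by
  refine exists_congr fun k => and_congr_right fun _ => ?_
  set F : ∀ k : ℕ, Δ.Chain 𝕜 k →ₗ[𝕜] ((Fin k → V) →₀ 𝕜) :=
    fun k => Finsupp.lmapDomain 𝕜 𝕜 Subtype.val with hF
  have hFinj : ∀ k, Function.Injective (F k) :=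
    fun k => Finsupp.mapDomain_injective Subtype.val_injective
  have hFs : ∀ k t a, F k (Finsupp.single t a) = Finsupp.single t.1 a :=
    fun k t a => Finsupp.mapDomain_single
  have hFb : ∀ k z, bdry 𝕜 k (F (k + 1) z) = F k (Δ.boundary 𝕜 k z) := by
    intro k z
    induction z using Finsupp.induction_linear with
    | zero => simp
    | add f g hf hg => simp [hf, hg]
    | single t a =>
      have hb : Δ.boundary 𝕜 k (Finsupp.single t a) = ∑ j : Fin (k + 1),
          (-1 : 𝕜) ^ (j : ℕ) • Finsupp.single (t.dropEntry j) a := by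
        simp [PreAbstractSimplicialComplex.boundary]
      rw [hFs, bdry_single, hb, map_sum]
      exact Finset.sum_congr rfl fun j _ => by rw [map_smul, hFs]; rfl
  have hFc : ∀ k z, IsCycle 𝕜 k (F k z) ↔ z ∈ Δ.cycles 𝕜 k := by
    intro k z
    cases k with
    | zero => simp [IsCycle, PreAbstractSimplicialComplex.cycles]
    | succ k =>
      simp only [IsCycle, PreAbstractSimplicialComplex.cycles, LinearMap.mem_ker]
      rw [hFb, ← map_zero (F k), (hFinj k).eq_iff]
  have hch : ∀ k, chains 𝕜 Δ.allFaces k = LinearMap.range (F k) := by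
    intro k
    have : simplices Δ.allFaces k =
        (Subtype.val : Δ.OrderedSimplex k → (Fin k → V)) '' Set.univ := by
      rw [Set.image_univ]
      exact Subtype.range_val.symm
    rw [chains, this, ← Finsupp.lmapDomain_supported, Finsupp.supported_univ, Submodule.map_top]
    rfl
  rw [Submodule.nontrivial_iff_ne_bot, not_iff_not, ← LinearMap.le_ker_iff_map,
    Submodule.ker_mkQ]
  constructor
  · intro h z hz hc
    rw [hch] at hz
    obtain ⟨z, rfl⟩ := hz
    obtain ⟨w, rfl⟩ := h ((hFc k z).1 hc)
    exact ⟨F (k + 1) w, hch (k + 1) ▸ LinearMap.mem_range_self _ _, hFb _ _⟩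
  · intro h z hz
    obtain ⟨w, hw, hwz⟩ := h (F k z) (hch k ▸ LinearMap.mem_range_self _ _) ((hFc k z).2 hz)
    rw [hch] at hw
    obtain ⟨w, rfl⟩ := hw
    exact ⟨w, hFinj k (by rw [← hFb, hwz])⟩

end OrderedChains

/-! Removal of faces, links of vertices, and vanishing above the dimension. -/

namespace OrderedChains

variable {V : Type*} {𝕜 : Type*} [Field 𝕜] {K : Set (Finset V)}

theorem isLowerSet_avoiding (hK : IsLowerSet K) (P : Finset V → Prop) :
    IsLowerSet {ρ ∈ K | ∀ τ, P τ → ¬ τ ⊆ ρ} :=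
  fun _ _ hle h => ⟨hK hle h.1, fun τ hτ hτρ => h.2 τ hτ (hτρ.trans hle)⟩

theorem isLowerSet_del (hK : IsLowerSet K) (x : V) : IsLowerSet {ρ ∈ K | x ∉ ρ} :=
  fun _ _ hle h => ⟨hK hle h.1, fun h' => h.2 (hle h')⟩

theorem acyclicAt_of_forall_singleton_notMem (hK : IsLowerSet K)
    (h : ∀ x, {x} ∉ K) (k : ℕ) : AcyclicAt 𝕜 (k + 1) K := by
  have he : simplices K (k + 1) = ∅ := Set.eq_empty_of_forall_notMem fun t ⟨σ, hσ, ht⟩ =>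
    h (t 0) (hK (Finset.singleton_subset_iff.2 (ht 0)) hσ)
  intro z hz _
  rw [chains, he, Finsupp.supported_empty, Submodule.mem_bot] at hz
  exact ⟨0, zero_mem _, by rw [map_zero, hz]⟩

theorem del_ssubset {x : V} (hx : {x} ∈ K) : {ρ ∈ K | x ∉ ρ} ⊂ K :=
  ⟨fun _ h => h.1, fun h => (h hx).2 (Finset.mem_singleton_self x)⟩

/-- There are no vertices, so nothing bounds the empty simplex. Applied to the link of a face of
maximal size, this is the source of nonvanishing homology in the main argument. -/
theorem not_acyclicAt_zero_of_eq_singleton (h : K = {∅}) : ¬ AcyclicAt 𝕜 0 K := by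
  subst h
  intro hac
  obtain ⟨w, hw, hwz⟩ := hac (Finsupp.single Fin.elim0 1)
    (single_mem_chains ⟨∅, Set.mem_singleton _, fun j => j.elim0⟩ (1 : 𝕜)) trivial
  have he : simplices ({∅} : Set (Finset V)) 1 = ∅ :=
    Set.eq_empty_of_forall_notMem fun t ⟨σ, hσ, ht⟩ => by
      rw [Set.mem_singleton_iff.1 hσ] at ht
      exact Finset.notMem_empty _ (ht 0)
  rw [chains, he, Finsupp.supported_empty, Submodule.mem_bot] at hw
  rw [hw, map_zero] at hwz
  exact one_ne_zero (Finsupp.single_eq_zero.1 hwz.symm)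

variable [DecidableEq V]

/-- The link of a finite set in a family of finite sets. -/
def linkFamily (K : Set (Finset V)) (σ : Finset V) : Set (Finset V) :=
  {τ | Disjoint σ τ ∧ σ ∪ τ ∈ K}

theorem isLowerSet_linkFamily (hK : IsLowerSet K) (σ : Finset V) :
    IsLowerSet (linkFamily K σ) :=
  fun _ _ hle h => ⟨h.1.mono_right hle, hK (Finset.union_subset_union_right hle) h.2⟩

theorem linkFamily_linkFamily_singleton (C : Finset V) {x : V} (hx : x ∉ C) :
    linkFamily (linkFamily K C) {x} = linkFamily K (insert x C) := by
  ext τ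
  have h : C ∪ ({x} ∪ τ) = insert x C ∪ τ := by ext; simp
  simp only [linkFamily, Set.mem_ofPred_eq, h, Finset.disjoint_singleton_left,
    Finset.disjoint_union_right, Finset.disjoint_singleton_right, Finset.disjoint_insert_left]
  tauto

/-- If the link of `τ` is a cone with apex `u`, then removing all faces containing `τ` does not
change the homology. -/
theorem acyclicAt_avoiding_iff (hK : IsLowerSet K) {τ : Finset V} {u : V} (hu : u ∉ τ)
    (h : ∀ ρ ∈ K, τ ⊆ ρ → insert u ρ ∈ K) (k : ℕ) :
    AcyclicAt 𝕜 k {ρ ∈ K | ¬ τ ⊆ ρ} ↔ AcyclicAt 𝕜 k K := by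
  set A : Set (Finset V) := {ρ ∈ K | ¬ τ ⊆ ρ} with hA
  set B : Set (Finset V) := {ρ | ρ ∪ τ ∈ K} with hB
  have hlA : IsLowerSet A := fun ρ ρ' hle h => ⟨hK hle h.1, fun h' => h.2 (h'.trans hle)⟩
  have hlB : IsLowerSet B := fun ρ ρ' hle h => hK (Finset.union_subset_union_left hle) h
  have hcone : ∀ ρ ∈ B, insert u ρ ∈ B := fun ρ hρ => by
    simpa [hB, Finset.insert_union] using h _ hρ Finset.subset_union_right
  have hAB : A ∪ B = K := by
    ext ρ
    constructor
    · rintro (h | h)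
      · exact h.1
      · exact hK Finset.subset_union_left h
    · intro h
      by_cases h' : τ ⊆ ρ
      · right
        simpa [hB, Finset.union_eq_left.2 h'] using h
      · exact Or.inl ⟨h, h'⟩
  -- B is the star of τ. Both B and A ∩ B are cones with apex u, the latter because u ∉ τ means that
  -- inserting u cannot complete τ. Mayer–Vietoris then compares A with A ∪ B = K.
  have hBa := acyclicAt_of_cone (𝕜 := 𝕜) u hcone
  have hIa := acyclicAt_of_cone (𝕜 := 𝕜) (K := A ∩ B) u fun ρ hρ => by
    refine ⟨⟨hK Finset.subset_union_left (hcone ρ hρ.2), fun h' => hρ.1.2 ?_⟩, hcone ρ hρ.2⟩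
    rwa [Finset.subset_insert_iff_of_notMem hu] at h'
  rw [← hAB]
  constructor
  · intro h
    cases k with
    | zero => exact h.union_zero (hBa 0)
    | succ k => exact h.union_succ hlA hlB (hBa _) (hIa _)
  · intro h
    exact h.of_union_left hlA hlB (hIa k)

/-- Removing all faces containing some member of `T`, in the order of increasing `μ`. -/
theorem acyclicAt_avoiding_finset_iff (hK : IsLowerSet K) (μ : Finset V → ℤ)
    (T : Finset (Finset V))
    (h : ∀ τ ∈ T, ∃ u, u ∉ τ ∧ ∀ ρ ∈ K, τ ⊆ ρ → (∀ τ' ∈ T, τ' ⊆ ρ → μ τ ≤ μ τ') →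
      insert u ρ ∈ K ∧ ∀ τ' ∈ T, τ' ⊆ insert u ρ → τ' ⊆ ρ) (k : ℕ) :
    AcyclicAt 𝕜 k {ρ ∈ K | ∀ τ ∈ T, ¬ τ ⊆ ρ} ↔ AcyclicAt 𝕜 k K := by
  induction T using Finset.induction_on_max_value μ with
  | empty => simp
  | insert τ₀ T hτ₀ hmax ih =>
    have ih' := ih fun τ hτ => by
      obtain ⟨u, hu, hρ⟩ := h τ (Finset.mem_insert_of_mem hτ)
      refine ⟨u, hu, fun ρ hρK hτρ hmin => ?_⟩
      obtain ⟨h1, h2⟩ := hρ ρ hρK hτρ fun τ' hτ' hτ'ρ => by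
        rcases Finset.mem_insert.1 hτ' with rfl | hτ'
        · exact hmax τ hτ
        · exact hmin τ' hτ' hτ'ρ
      exact ⟨h1, fun τ' hτ' => h2 τ' (Finset.mem_insert_of_mem hτ')⟩
    rw [← ih']
    obtain ⟨u, hu, hρ⟩ := h τ₀ (Finset.mem_insert_self _ _)
    rw [← acyclicAt_avoiding_iff (isLowerSet_avoiding hK (· ∈ T)) hu]
    · apply iff_of_eq
      congr 1
      ext ρ
      simp only [Finset.mem_insert, forall_eq_or_imp, Set.mem_ofPred_eq]
      tauto
    · intro ρ hρ' hτ₀ρ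
      obtain ⟨h1, h2⟩ := hρ ρ hρ'.1 hτ₀ρ fun τ' hτ' hτ'ρ => by
        rcases Finset.mem_insert.1 hτ' with rfl | hτ'
        · exact le_rfl
        · exact absurd hτ'ρ (hρ'.2 τ' hτ')
      exact ⟨h1, fun τ hτ hτρ => hρ'.2 τ hτ (h2 τ (Finset.mem_insert_of_mem hτ) hτρ)⟩

theorem acyclicAt_avoiding_set_iff [Finite V] (hK : IsLowerSet K) (μ : Finset V → ℤ)
    (T : Set (Finset V))
    (h : ∀ τ ∈ T, ∃ u, u ∉ τ ∧ ∀ ρ ∈ K, τ ⊆ ρ → (∀ τ' ∈ T, τ' ⊆ ρ → μ τ ≤ μ τ') →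
      insert u ρ ∈ K ∧ ∀ τ' ∈ T, τ' ⊆ insert u ρ → τ' ⊆ ρ) (k : ℕ) :
    AcyclicAt 𝕜 k {ρ ∈ K | ∀ τ ∈ T, ¬ τ ⊆ ρ} ↔ AcyclicAt 𝕜 k K := by
  have := acyclicAt_avoiding_finset_iff (𝕜 := 𝕜) hK μ (Set.toFinite T).toFinset
    (by simpa only [Set.Finite.mem_toFinset] using h) k
  simpa only [Set.Finite.mem_toFinset] using this

/-! ### Deletion, star and link of a vertex. -/

section Vertex

theorem del_union_star (hK : IsLowerSet K) (x : V) :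
    {ρ ∈ K | x ∉ ρ} ∪ {ρ | insert x ρ ∈ K} = K := by
  ext ρ
  constructor
  · rintro (h | h)
    · exact h.1
    · exact hK (Finset.subset_insert _ _) h
  · intro h
    by_cases h' : x ∈ ρ
    · right
      simpa [Finset.insert_eq_self.2 h'] using h
    · exact Or.inl ⟨h, h'⟩

theorem del_inter_star (hK : IsLowerSet K) (x : V) :
    {ρ ∈ K | x ∉ ρ} ∩ {ρ | insert x ρ ∈ K} = linkFamily K {x} := by
  ext ρ
  simp only [linkFamily, Set.mem_inter_iff, Set.mem_ofPred_eq, Finset.disjoint_singleton_left,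
    ← Finset.insert_eq]
  exact ⟨fun h => ⟨h.1.2, h.2⟩, fun h => ⟨⟨hK (Finset.subset_insert _ _) h.2, h.1⟩, h.2⟩⟩

theorem isLowerSet_star (hK : IsLowerSet K) (x : V) : IsLowerSet {ρ | insert x ρ ∈ K} :=
  fun _ _ hle h => hK (Finset.insert_subset_insert _ hle) h

theorem acyclicAt_star (x : V) (k : ℕ) : AcyclicAt 𝕜 k {ρ | insert x ρ ∈ K} :=
  acyclicAt_of_cone x (fun ρ hρ => by simpa using hρ) k

theorem acyclicAt_succ_of_del_of_link (hK : IsLowerSet K) (x : V) {k : ℕ}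
    (hd : AcyclicAt 𝕜 (k + 1) {ρ ∈ K | x ∉ ρ}) (hl : AcyclicAt 𝕜 k (linkFamily K {x})) :
    AcyclicAt 𝕜 (k + 1) K := by
  rw [← del_inter_star hK] at hl
  have := hd.union_succ (isLowerSet_del hK x) (isLowerSet_star hK x) (acyclicAt_star x _) hl
  rwa [del_union_star hK] at this

/-- If the deletion of `x` is acyclic, the complex is a homology suspension of the link of `x`. -/
theorem acyclicAt_succ_iff_link (hK : IsLowerSet K) (x : V)
    (hd : ∀ k, AcyclicAt 𝕜 k {ρ ∈ K | x ∉ ρ}) (k : ℕ) :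
    AcyclicAt 𝕜 (k + 1) K ↔ AcyclicAt 𝕜 k (linkFamily K {x}) := by
  refine ⟨fun h => ?_, acyclicAt_succ_of_del_of_link hK x (hd _)⟩
  rw [← del_inter_star hK]
  rw [← del_union_star hK x] at h
  exact h.inter (isLowerSet_del hK x) (isLowerSet_star hK x) (hd k) (acyclicAt_star x k)

/-- Supplies the lowest degree, which the degree shift in `acyclicAt_succ_iff_link` does not reach.
-/
theorem acyclicAt_zero_of_del (hK : IsLowerSet K) (x : V)
    (hd : AcyclicAt 𝕜 0 {ρ ∈ K | x ∉ ρ}) : AcyclicAt 𝕜 0 K := by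
  rw [← del_union_star hK x]
  exact hd.union_zero (acyclicAt_star x 0)

end Vertex

/-! ### Homology in and above the top degree. -/

section Dimension

theorem linkFamily_singleton_subset_del (hK : IsLowerSet K) (x : V) :
    linkFamily K {x} ⊆ {ρ ∈ K | x ∉ ρ} := by
  rw [← del_inter_star hK]
  exact Set.inter_subset_left

theorem card_add_one_of_mem_linkFamily {x : V} {ρ : Finset V} (h : ρ ∈ linkFamily K {x}) :
    insert x ρ ∈ K ∧ (insert x ρ).card = ρ.card + 1 :=
  ⟨h.2, Finset.card_insert_of_notMem (Finset.disjoint_singleton_left.1 h.1)⟩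

variable [Finite V]

/-- Homology vanishes above the dimension. -/
theorem acyclicAt_of_card_lt (hK : IsLowerSet K) {k : ℕ} (h : ∀ ρ ∈ K, ρ.card < k) :
    AcyclicAt 𝕜 k K := by
  induction K using WellFoundedLT.induction generalizing k with
  | ind K ih =>
  cases k with
  | zero =>
    have : K = ∅ := Set.eq_empty_of_forall_notMem fun ρ hρ => absurd (h ρ hρ) (Nat.not_lt_zero _)
    intro z hz _
    have he : simplices K 0 = ∅ := Set.eq_empty_of_forall_notMem fun t ⟨σ, hσ, _⟩ => by
      rw [this] at hσ
      exact hσ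
    rw [chains, he, Finsupp.supported_empty, Submodule.mem_bot] at hz
    exact ⟨0, zero_mem _, by rw [map_zero, hz]⟩
  | succ k =>
    by_cases hx : ∃ x, {x} ∈ K
    · obtain ⟨x, hx⟩ := hx
      refine acyclicAt_succ_of_del_of_link hK x
        (ih _ (del_ssubset hx) (isLowerSet_del hK x) fun ρ hρ => h ρ hρ.1)
        (ih _ ((linkFamily_singleton_subset_del hK x).trans_ssubset (del_ssubset hx))
          (isLowerSet_linkFamily hK _) fun ρ hρ => ?_)
      obtain ⟨h1, h2⟩ := card_add_one_of_mem_linkFamily hρ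
      have := h _ h1
      omega
    · exact acyclicAt_of_forall_singleton_notMem hK (not_exists.1 hx) k

/-- In the top degree, vanishing of homology passes to subcomplexes. -/
theorem AcyclicAt.mono_of_card_le {A : Set (Finset V)} (hK : IsLowerSet K) (hA : IsLowerSet A)
    (hAK : A ⊆ K) {k : ℕ} (h : ∀ ρ ∈ K, ρ.card ≤ k) (hac : AcyclicAt 𝕜 k K) :
    AcyclicAt 𝕜 k A := by
  induction K using WellFoundedLT.induction with
  | ind K ih =>
  rcases hAK.eq_or_ssubset with rfl | hss
  · exact hac
  obtain ⟨G, hGK, hGA⟩ := Set.exists_of_ssubset hss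
  -- A maximal F outside A is a facet of K. Removing it leaves a complex that meets the full simplex
  -- on F in its proper subsets, all of size less than k, so the intersection has no homology in
  -- degree k - 1.
  obtain ⟨F, ⟨hFK, hFA⟩, hmax⟩ := (Set.toFinite (K \ A)).exists_maximal ⟨G, hGK, hGA⟩
  have hF : ∀ ρ ∈ K, F ⊆ ρ → ρ = F := fun ρ hρ hFρ =>
    le_antisymm (hmax ⟨hρ, fun h' => hFA (hA hFρ h')⟩ hFρ) hFρ
  have hl : IsLowerSet (K \ {F}) := fun ρ ρ' hle hρ =>
    ⟨hK hle hρ.1, fun h' => hρ.2 (hF ρ hρ.1 (h' ▸ hle))⟩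
  have hU : K \ {F} ∪ Set.Iic F = K := by
    ext ρ
    constructor
    · rintro (h' | h')
      · exact h'.1
      · exact hK h' hFK
    · intro h'
      by_cases hρ : ρ = F
      · exact Or.inr hρ.le
      · exact Or.inl ⟨h', hρ⟩
  refine ih (K \ {F}) ⟨Set.sdiff_subset, fun h' => (h' hFK).2 rfl⟩ hl
    (fun ρ hρ => ⟨hAK hρ, fun h' => hFA (h' ▸ hρ)⟩) (fun ρ hρ => h ρ hρ.1) ?_
  refine AcyclicAt.of_union_left hl (isLowerSet_Iic F) (hU.symm ▸ hac)
    (acyclicAt_of_card_lt (hl.inter (isLowerSet_Iic F)) fun ρ hρ => ?_)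
  exact (Finset.card_lt_card (lt_of_le_of_ne hρ.2 hρ.1.2)).trans_le (h F hFK)

/-- Nonzero top homology is inherited by the link of some vertex. -/
theorem exists_not_acyclicAt_link (hK : IsLowerSet K) {k : ℕ} (h : ∀ ρ ∈ K, ρ.card ≤ k + 1)
    (hac : ¬ AcyclicAt 𝕜 (k + 1) K) : ∃ x, {x} ∈ K ∧ ¬ AcyclicAt 𝕜 k (linkFamily K {x}) := by
  induction K using WellFoundedLT.induction with
  | ind K ih =>
  by_contra! hcon
  have hx : ∃ x, {x} ∈ K := by
    by_contra hx
    exact hac (acyclicAt_of_forall_singleton_notMem hK (not_exists.1 hx) k)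
  obtain ⟨x, hx⟩ := hx
  have hd : ¬ AcyclicAt 𝕜 (k + 1) {ρ ∈ K | x ∉ ρ} := fun hd =>
    hac (acyclicAt_succ_of_del_of_link hK x hd (hcon x hx))
  obtain ⟨y, hy, hyl⟩ := ih _ (del_ssubset hx) (isLowerSet_del hK x) (fun ρ hρ => h ρ hρ.1) hd
  -- The link of y in the deletion of x is a subcomplex of its link in K, so the assumed top-degree
  -- vanishing in K contradicts `hyl`.
  refine hyl (AcyclicAt.mono_of_card_le (isLowerSet_linkFamily hK _)
    (isLowerSet_linkFamily (isLowerSet_del hK x) _) (fun ρ hρ => ⟨hρ.1, hρ.2.1⟩)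
    (fun ρ hρ => ?_) (hcon y hy.1))
  obtain ⟨h1, h2⟩ := card_add_one_of_mem_linkFamily hρ
  have := h _ h1
  omega

end Dimension

end OrderedChains

/-! Links in the barycentric subdivision. -/

namespace OrderedChains

open PreAbstractSimplicialComplex

variable {V : Type*} {𝕜 : Type*} [Field 𝕜] (Δ : PreAbstractSimplicialComplex V)

theorem isLowerSet_allFaces : IsLowerSet Δ.allFaces := by
  rintro ρ τ hle (rfl | h)
  · exact Or.inl (Finset.subset_empty.1 hle)
  · rcases τ.eq_empty_or_nonempty with rfl | hτ
    · exact Or.inl rfl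
    · exact Or.inr ((Δ.isRelLowerSet_faces h).2 hle hτ)

variable {Δ}

theorem nonempty_of_mem_faces {σ : Finset V} (h : σ ∈ Δ.faces) : σ.Nonempty :=
  (Δ.isRelLowerSet_faces h).1

theorem mem_faces_of_mem_allFaces {σ : Finset V} (h : σ ∈ Δ.allFaces) (hne : σ.Nonempty) :
    σ ∈ Δ.faces :=
  h.resolve_left hne.ne_empty

theorem mem_allFaces_barycentricSubdivision {t : Finset {σ // σ ∈ Δ.faces}} :
    t ∈ Δ.barycentricSubdivision.allFaces ↔ ∀ a ∈ t, ∀ b ∈ t, a.1 ⊆ b.1 ∨ b.1 ⊆ a.1 := by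
  constructor
  · rintro (rfl | ⟨-, h⟩) a ha b hb
    · simp at ha
    · by_cases hab : a = b
      · exact Or.inl (hab ▸ subset_rfl)
      · exact h ha hb hab
  · intro h
    rcases t.eq_empty_or_nonempty with rfl | ht
    · exact Or.inl rfl
    · exact Or.inr ⟨ht, fun a ha b hb _ => h a ha b hb⟩

variable (Δ) in
/-- The chains of faces of `Δ` lying strictly above `σ`. -/
def upperChains (σ : Finset V) : Set (Finset {σ // σ ∈ Δ.faces}) :=
  {t | t ∈ Δ.barycentricSubdivision.allFaces ∧ ∀ y ∈ t, σ ⊂ y.1}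

theorem isLowerSet_upperChains (σ : Finset V) : IsLowerSet (upperChains Δ σ) :=
  fun _ _ hle h => ⟨isLowerSet_allFaces _ hle h.1, fun y hy => h.2 y (hle hy)⟩

/-! ### Sizes along a chain of faces. -/

theorem injOn_card_of_mem_allFaces {C : Finset {σ // σ ∈ Δ.faces}}
    (hC : C ∈ Δ.barycentricSubdivision.allFaces) :
    Set.InjOn (fun y : {σ // σ ∈ Δ.faces} => y.1.card) C := by
  intro a ha b hb hab
  rcases mem_allFaces_barycentricSubdivision.1 hC a ha b hb with h | h
  · exact Subtype.ext (Finset.eq_of_subset_of_card_le h hab.ge)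
  · exact Subtype.ext (Finset.eq_of_subset_of_card_le h hab.le).symm

theorem image_card_subset_Icc {C : Finset {σ // σ ∈ Δ.faces}} {σ : {σ // σ ∈ Δ.faces}}
    (htop : ∀ y ∈ C, y.1 ⊆ σ.1) :
    C.image (fun y : {σ // σ ∈ Δ.faces} => y.1.card) ⊆ Finset.Icc 1 σ.1.card := by
  intro n hn
  obtain ⟨y, hy, rfl⟩ := Finset.mem_image.1 hn
  exact Finset.mem_Icc.2
    ⟨(nonempty_of_mem_faces y.2).card_pos, Finset.card_le_card (htop y hy)⟩

theorem exists_top_of_mem_allFaces {C : Finset {σ // σ ∈ Δ.faces}}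
    (hC : C ∈ Δ.barycentricSubdivision.allFaces) (hne : C.Nonempty) :
    ∃ σ ∈ C, ∀ y ∈ C, y.1 ⊆ σ.1 := by
  obtain ⟨σ, hσ, hmax⟩ := Finset.exists_max_image C
    (fun y : {σ // σ ∈ Δ.faces} => y.1.card) hne
  refine ⟨σ, hσ, fun y hy => ?_⟩
  rcases mem_allFaces_barycentricSubdivision.1 hC y hy σ hσ with h | h
  · exact h
  · exact (Finset.eq_of_subset_of_card_le h (hmax y hy)).ge

theorem card_chain_le {C : Finset {σ // σ ∈ Δ.faces}}
    (hC : C ∈ Δ.barycentricSubdivision.allFaces) {σ : {σ // σ ∈ Δ.faces}}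
    (htop : ∀ y ∈ C, y.1 ⊆ σ.1) : C.card ≤ σ.1.card := by
  have := Finset.card_le_card (image_card_subset_Icc htop)
  rwa [Finset.card_image_of_injOn (injOn_card_of_mem_allFaces hC), Nat.card_Icc,
    Nat.add_sub_cancel] at this

/-- A chain which is not saturated below its top member has two consecutive members (the lower
one possibly the empty set) whose sizes differ by at least two. -/
theorem exists_gap {C : Finset {σ // σ ∈ Δ.faces}}
    (hC : C ∈ Δ.barycentricSubdivision.allFaces) {σ : {σ // σ ∈ Δ.faces}} (hσ : σ ∈ C)
    (hcard : C.card < σ.1.card) :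
    ∃ s ∈ C, ∃ ρ : Finset V, (ρ = ∅ ∨ ∃ r ∈ C, r.1 = ρ) ∧ (∀ y ∈ C, y.1 ⊆ ρ ∨ s.1 ⊆ y.1) ∧
      ρ ⊆ s.1 ∧ ρ.card + 2 ≤ s.1.card := by
  have hcmp := mem_allFaces_barycentricSubdivision.1 hC
  -- By counting, some size m between 1 and |σ| is missed by C. The smallest member above m and the
  -- largest one below m (or ∅) then differ in size by at least two.
  obtain ⟨m, hm, hmC⟩ : ∃ m ∈ Finset.Icc 1 σ.1.card,
      m ∉ C.image (fun y : {σ // σ ∈ Δ.faces} => y.1.card) := by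
    refine Finset.exists_mem_notMem_of_card_lt_card ?_
    rwa [Finset.card_image_of_injOn (injOn_card_of_mem_allFaces hC), Nat.card_Icc,
      Nat.add_sub_cancel]
  rw [Finset.mem_Icc] at hm
  have hne : ∀ y ∈ C, y.1.card ≠ m := fun y hy h => hmC (Finset.mem_image.2 ⟨y, hy, h⟩)
  obtain ⟨s, hs, hmin⟩ := Finset.exists_min_image {y ∈ C | m < y.1.card}
    (fun y : {σ // σ ∈ Δ.faces} => y.1.card)
    ⟨σ, Finset.mem_filter.2 ⟨hσ, lt_of_le_of_ne hm.2 (hne σ hσ).symm⟩⟩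
  rw [Finset.mem_filter] at hs
  have hsub : ∀ a ∈ C, ∀ b ∈ C, a.1.card ≤ b.1.card → a.1 ⊆ b.1 := by
    intro a ha b hb hab
    rcases hcmp a ha b hb with h | h
    · exact h
    · exact (Finset.eq_of_subset_of_card_le h hab).ge
  have hup : ∀ y ∈ C, m < y.1.card → s.1 ⊆ y.1 := fun y hy hmy =>
    hsub s hs.1 y hy (hmin y (Finset.mem_filter.2 ⟨hy, hmy⟩))
  rcases (Finset.filter (fun y : {σ // σ ∈ Δ.faces} => y.1.card < m) C).eq_empty_or_nonempty
    with he | hnon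
  · refine ⟨s, hs.1, ∅, Or.inl rfl, fun y hy => Or.inr (hup y hy ?_), Finset.empty_subset _, ?_⟩
    · have h1 : ¬ y.1.card < m := fun h =>
        Finset.notMem_empty y (he ▸ Finset.mem_filter.2 ⟨hy, h⟩)
      have := hne y hy
      omega
    · rw [Finset.card_empty]
      omega
  · obtain ⟨r, hr, hmax⟩ := Finset.exists_max_image _
      (fun y : {σ // σ ∈ Δ.faces} => y.1.card) hnon
    rw [Finset.mem_filter] at hr
    refine ⟨s, hs.1, r.1, Or.inr ⟨r, hr.1, rfl⟩, fun y hy => ?_, hsub r hr.1 s hs.1 ?_, ?_⟩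
    · rcases lt_or_gt_of_ne (hne y hy) with h | h
      · exact Or.inl (hsub y hy r hr.1 (hmax y (Finset.mem_filter.2 ⟨hy, h⟩)))
      · exact Or.inr (hup y hy h)
    · omega
    · omega

variable [DecidableEq V]

theorem allFaces_link {σ : Finset V} (hσ : σ ∈ Δ.allFaces) :
    (Δ.link σ).allFaces = linkFamily Δ.allFaces σ := by
  ext τ
  constructor
  · rintro (rfl | ⟨-, hd, h⟩)
    · exact ⟨Finset.disjoint_empty_right _, by rwa [Finset.union_empty]⟩
    · exact ⟨hd, Or.inr h⟩
  · rintro ⟨hd, h⟩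
    rcases τ.eq_empty_or_nonempty with rfl | hτ
    · exact Or.inl rfl
    · exact Or.inr ⟨hτ, hd, mem_faces_of_mem_allFaces h (hτ.mono Finset.subset_union_right)⟩

theorem insert_mem_allFaces_barycentricSubdivision {t : Finset {σ // σ ∈ Δ.faces}}
    {a : {σ // σ ∈ Δ.faces}} (ht : t ∈ Δ.barycentricSubdivision.allFaces)
    (h : ∀ b ∈ t, a.1 ⊆ b.1 ∨ b.1 ⊆ a.1) :
    insert a t ∈ Δ.barycentricSubdivision.allFaces := by
  rw [mem_allFaces_barycentricSubdivision] at ht ⊢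
  intro b hb c hc
  rcases Finset.mem_insert.1 hb with hba | hbt <;> rcases Finset.mem_insert.1 hc with hca | hct
  · exact Or.inl (hba.trans hca.symm ▸ subset_rfl)
  · exact hba ▸ h c hct
  · exact hca ▸ (h b hbt).symm
  · exact ht b hbt c hct

/-! ### Links of saturated chains and the mapping cylinder. -/

variable (Δ) in
/-- The mapping cylinder between the link of `σ` and the chains of faces above `σ`: its faces
consist of a face `τ` of the link and a chain of faces containing `σ ∪ τ`. -/
def cylinder (σ : Finset V) : Set (Finset (V ⊕ {σ // σ ∈ Δ.faces})) :=
  {ρ | ρ.toLeft ∈ linkFamily Δ.allFaces σ ∧ ρ.toRight ∈ upperChains Δ σ ∧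
    ∀ y ∈ ρ.toRight, ρ.toLeft ⊆ y.1}

theorem isLowerSet_cylinder (σ : Finset V) : IsLowerSet (cylinder Δ σ) := by
  intro ρ ρ' hle h
  have hl : ρ'.toLeft ⊆ ρ.toLeft := Finset.toLeft_subset_toLeft hle
  have hr : ρ'.toRight ⊆ ρ.toRight := Finset.toRight_subset_toRight hle
  exact ⟨isLowerSet_linkFamily (isLowerSet_allFaces Δ) σ hl h.1, isLowerSet_upperChains σ hr h.2.1,
    fun y hy => hl.trans (h.2.2 y (hr hy))⟩

/-- Here C has exactly one member of each size from 1 to |σ|. A face inside σ comparable with all of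
C must equal the member of its own size, so new faces can only be added above σ. -/
theorem linkFamily_eq_upperChains {C : Finset {σ // σ ∈ Δ.faces}}
    (hC : C ∈ Δ.barycentricSubdivision.allFaces) {σ : {σ // σ ∈ Δ.faces}} (hσ : σ ∈ C)
    (htop : ∀ y ∈ C, y.1 ⊆ σ.1) (hcard : C.card = σ.1.card) :
    linkFamily Δ.barycentricSubdivision.allFaces C = upperChains Δ σ.1 := by
  have himg : C.image (fun y : {σ // σ ∈ Δ.faces} => y.1.card) = Finset.Icc 1 σ.1.card := by
    refine Finset.eq_of_subset_of_card_le (image_card_subset_Icc htop) ?_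
    rw [Finset.card_image_of_injOn (injOn_card_of_mem_allFaces hC), Nat.card_Icc, hcard,
      Nat.add_sub_cancel]
  ext t
  constructor
  · rintro ⟨hd, ht⟩
    refine ⟨isLowerSet_allFaces _ Finset.subset_union_right ht, fun y hy => ?_⟩
    have hcmp : ∀ z ∈ C, z.1 ⊆ y.1 ∨ y.1 ⊆ z.1 := fun z hz =>
      mem_allFaces_barycentricSubdivision.1 ht z (Finset.mem_union_left _ hz) y
        (Finset.mem_union_right _ hy)
    have hyC : y ∉ C := fun h => Finset.disjoint_left.1 hd h hy
    by_contra hn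
    have hyσ : y.1 ⊆ σ.1 := by
      rcases hcmp σ hσ with h | h
      · by_contra h'
        exact hn ⟨h, h'⟩
      · exact h
    have hmem : y.1.card ∈ C.image (fun y : {σ // σ ∈ Δ.faces} => y.1.card) := by
      rw [himg]
      exact Finset.mem_Icc.2 ⟨(nonempty_of_mem_faces y.2).card_pos, Finset.card_le_card hyσ⟩
    obtain ⟨z, hz, hzy⟩ := Finset.mem_image.1 hmem
    refine hyC ?_
    rcases hcmp z hz with h | h
    · rwa [← Subtype.ext (Finset.eq_of_subset_of_card_le h hzy.ge)]
    · rwa [Subtype.ext (Finset.eq_of_subset_of_card_le h hzy.le)]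
  · rintro ⟨ht, hup⟩
    refine ⟨Finset.disjoint_left.2 fun y hyC hyt => (hup y hyt).2 (htop y hyC), ?_⟩
    rw [mem_allFaces_barycentricSubdivision] at hC ht ⊢
    intro a ha b hb
    rcases Finset.mem_union.1 ha with ha | ha <;> rcases Finset.mem_union.1 hb with hb | hb
    · exact hC a ha b hb
    · exact Or.inl ((htop a ha).trans (hup b hb).1)
    · exact Or.inr ((htop b hb).trans (hup a ha).1)
    · exact ht a ha b hb

variable [Finite V]

/-- The cylinder collapses to its base by removing the vertices y above σ, smaller ones first. When
y is removed, the remaining chain members joined to it all contain y, so any v ∈ y \ σ is the apex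
of a cone. The sum in the weight only extends |y| from the singletons {y} to all finite sets. -/
theorem acyclicAt_linkFamily_iff_cylinder {σ : Finset V} (k : ℕ) :
    AcyclicAt 𝕜 k (linkFamily Δ.allFaces σ) ↔ AcyclicAt 𝕜 k (cylinder Δ σ) := by
  have key := acyclicAt_avoiding_set_iff (𝕜 := 𝕜) (isLowerSet_cylinder (Δ := Δ) σ)
    (fun τ => ∑ a ∈ τ, Sum.elim 0 (fun y => (y.1.card : ℤ)) a)
    {τ | ∃ y : {σ // σ ∈ Δ.faces}, σ ⊂ y.1 ∧ τ = {Sum.inr y}} ?_ k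
  · rw [← key, ← acyclicAt_image_iff (Function.Embedding.inl (β := {σ // σ ∈ Δ.faces}))]
    apply iff_of_eq
    congr 1
    ext ρ
    constructor
    · rintro ⟨τ, hτ, rfl⟩
      have h1 : (Finset.map (Function.Embedding.inl (β := {σ // σ ∈ Δ.faces})) τ).toLeft = τ := by
        ext; simp
      have h2 : (Finset.map (Function.Embedding.inl (β := {σ // σ ∈ Δ.faces})) τ).toRight = ∅ := by
        ext; simp
      refine ⟨⟨h1.symm ▸ hτ, ?_, ?_⟩, ?_⟩
      · rw [h2]
        exact ⟨Or.inl rfl, by simp⟩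
      · simp [h2]
      · rintro _ ⟨y, -, rfl⟩
        simp
    · rintro ⟨h, hT⟩
      refine ⟨ρ.toLeft, h.1, ?_⟩
      ext (v | y)
      · simp
      · have : Sum.inr y ∉ ρ := fun hy =>
          hT _ ⟨y, h.2.1.2 y (Finset.mem_toRight.2 hy), rfl⟩ (Finset.singleton_subset_iff.2 hy)
        simpa using this
  · rintro _ ⟨y, hσy, rfl⟩
    obtain ⟨v, hvy, hvσ⟩ := Finset.exists_of_ssubset hσy
    refine ⟨Sum.inl v, by simp, fun ρ hρ hyρ hmin => ⟨?_, ?_⟩⟩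
    · rw [Finset.singleton_subset_iff, ← Finset.mem_toRight] at hyρ
      have hl : (insert (Sum.inl v) ρ).toLeft = insert v ρ.toLeft := by ext; simp
      have hr : (insert (Sum.inl v) ρ).toRight = ρ.toRight := by ext; simp
      have hy : insert v ρ.toLeft ⊆ y.1 := Finset.insert_subset hvy (hρ.2.2 y hyρ)
      refine ⟨?_, hr.symm ▸ hρ.2.1, ?_⟩
      · rw [hl]
        exact ⟨Finset.disjoint_insert_right.2 ⟨hvσ, hρ.1.1⟩,
          isLowerSet_allFaces Δ (Finset.union_subset hσy.subset hy) (Or.inr y.2)⟩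
      · rw [hl, hr]
        intro z hz
        refine hy.trans ?_
        rcases mem_allFaces_barycentricSubdivision.1 hρ.2.1.1 y hyρ z hz with h | h
        · exact h
        · have := hmin {Sum.inr z} ⟨z, hρ.2.1.2 z hz, rfl⟩
            (Finset.singleton_subset_iff.2 (Finset.mem_toRight.1 hz))
          simp only [Finset.sum_singleton, Sum.elim_inr, Nat.cast_le] at this
          exact (Finset.eq_of_subset_of_card_le h this).ge
    · rintro _ ⟨z, -, rfl⟩
      simp

/-- The other end of the cylinder: nonempty faces τ of link σ are removed, larger ones first. When τ
is removed, the faces containing it have left part exactly τ and right part a chain of faces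
containing σ ∪ τ, so the vertex σ ∪ τ is the apex of a cone. -/
theorem acyclicAt_upperChains_iff_cylinder {σ : Finset V} (hσ : σ ∈ Δ.allFaces) (k : ℕ) :
    AcyclicAt 𝕜 k (upperChains Δ σ) ↔ AcyclicAt 𝕜 k (cylinder Δ σ) := by
  have key := acyclicAt_avoiding_set_iff (𝕜 := 𝕜) (isLowerSet_cylinder (Δ := Δ) σ)
    (fun τ => -(τ.card : ℤ))
    {τ | ∃ τ₀ ∈ linkFamily Δ.allFaces σ, τ₀.Nonempty ∧ τ = τ₀.map Function.Embedding.inl} ?_ k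
  · rw [← key, ← acyclicAt_image_iff (Function.Embedding.inr (α := V))]
    apply iff_of_eq
    congr 1
    ext ρ
    constructor
    · rintro ⟨t, ht, rfl⟩
      have h1 : (Finset.map (Function.Embedding.inr (α := V)) t).toLeft = ∅ := by
        ext; simp
      have h2 : (Finset.map (Function.Embedding.inr (α := V)) t).toRight = t := by
        ext; simp
      refine ⟨⟨?_, h2.symm ▸ ht, by simp [h1]⟩, ?_⟩
      · rw [h1]
        exact ⟨Finset.disjoint_empty_right _, by rwa [Finset.union_empty]⟩
      · rintro _ ⟨τ₀, -, ⟨v, hv⟩, rfl⟩ h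
        simpa using h (Finset.mem_map_of_mem _ hv)
    · rintro ⟨h, hT⟩
      refine ⟨ρ.toRight, h.2.1, ?_⟩
      ext (v | y)
      · have : Sum.inl v ∉ ρ := fun hv =>
          hT _ ⟨ρ.toLeft, h.1, ⟨v, Finset.mem_toLeft.2 hv⟩, rfl⟩ fun a ha => by
            obtain ⟨w, hw, rfl⟩ := Finset.mem_map.1 ha
            exact Finset.mem_toLeft.1 hw
        simpa using this
      · simp
  · rintro _ ⟨τ, hτ, hne, rfl⟩
    have hm : ∀ {ρ : Finset (V ⊕ {σ // σ ∈ Δ.faces})} {τ : Finset V},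
        τ.map Function.Embedding.inl ⊆ ρ ↔ τ ⊆ ρ.toLeft := by
      intro ρ τ
      simp [Finset.subset_iff]
    refine ⟨Sum.inr ⟨σ ∪ τ, mem_faces_of_mem_allFaces hτ.2 (hne.mono Finset.subset_union_right)⟩,
      by simp, fun ρ hρ hτρ hmin => ⟨?_, ?_⟩⟩
    · rw [hm] at hτρ
      have heq : τ = ρ.toLeft := by
        refine Finset.eq_of_subset_of_card_le hτρ ?_
        have := hmin _ ⟨ρ.toLeft, hρ.1, hne.mono hτρ, rfl⟩ (hm.2 subset_rfl)
        simpa using this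
      set u : {σ // σ ∈ Δ.faces} :=
        ⟨σ ∪ τ, mem_faces_of_mem_allFaces hτ.2 (hne.mono Finset.subset_union_right)⟩ with hu
      have hl : (insert (Sum.inr u) ρ).toLeft = ρ.toLeft := by ext; simp
      have hr : (insert (Sum.inr u) ρ).toRight = insert u ρ.toRight := by ext; simp
      refine ⟨hl.symm ▸ hρ.1, ?_, ?_⟩
      · rw [hr]
        refine ⟨insert_mem_allFaces_barycentricSubdivision hρ.2.1.1 fun b hb => Or.inl ?_, ?_⟩
        · exact Finset.union_subset (hρ.2.1.2 b hb).subset (heq ▸ hρ.2.2 b hb)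
        · intro y hy
          rcases Finset.mem_insert.1 hy with rfl | hy
          · refine ⟨Finset.subset_union_left, fun h => ?_⟩
            obtain ⟨v, hv⟩ := hne
            exact Finset.disjoint_left.1 hτ.1 (h (Finset.mem_union_right _ hv)) hv
          · exact hρ.2.1.2 y hy
      · rw [hl, hr]
        intro y hy
        rcases Finset.mem_insert.1 hy with rfl | hy
        · exact heq ▸ Finset.subset_union_right
        · exact hρ.2.2 y hy
    · rintro _ ⟨τ', -, -, rfl⟩
      rw [hm, hm]
      exact fun h v hv => by simpa using h hv

/-- The chains of faces strictly above `σ` have the homology of the link of `σ`. -/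
theorem acyclicAt_upperChains_iff {σ : Finset V} (hσ : σ ∈ Δ.allFaces) (k : ℕ) :
    AcyclicAt 𝕜 k (upperChains Δ σ) ↔ AcyclicAt 𝕜 k (linkFamily Δ.allFaces σ) :=
  (acyclicAt_upperChains_iff_cylinder hσ k).trans (acyclicAt_linkFamily_iff_cylinder k).symm

/-! ### Refining chains with a gap. -/

/-- Inside the link of a chain with consecutive members `ρ` and `s`, deleting a minimal element
above `ρ` leaves an acyclic complex. -/
theorem acyclicAt_del_of_gap {C : Finset {σ // σ ∈ Δ.faces}} {s x c : {σ // σ ∈ Δ.faces}}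
    (hs : s ∈ C) {ρ : Finset V} (hρ : ρ = ∅ ∨ ∃ r ∈ C, r.1 = ρ)
    (hgap : ∀ y ∈ C, y.1 ⊆ ρ ∨ s.1 ⊆ y.1) (hρs : ρ ⊆ s.1) {v : V} (hvs : v ∈ s.1) (hvρ : v ∉ ρ)
    (hx : x.1 = insert v ρ) (hc : c.1 = s.1.erase v) (hρc : c.1 ≠ ρ) (k : ℕ) :
    AcyclicAt 𝕜 k {t ∈ linkFamily Δ.barycentricSubdivision.allFaces C | x ∉ t} := by
  have hL := isLowerSet_linkFamily (isLowerSet_allFaces Δ.barycentricSubdivision) C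
  have hcmpρ : ∀ t ∈ linkFamily Δ.barycentricSubdivision.allFaces C, ∀ z ∈ t,
      z.1 ⊆ ρ ∨ ρ ⊆ z.1 := by
    intro t ht z hz
    rcases hρ with rfl | ⟨r, hr, rfl⟩
    · exact Or.inr (Finset.empty_subset _)
    · exact mem_allFaces_barycentricSubdivision.1 ht.2 z (Finset.mem_union_right _ hz) r
        (Finset.mem_union_left _ hr)
  have hcmps : ∀ t ∈ linkFamily Δ.barycentricSubdivision.allFaces C, ∀ z ∈ t,
      z.1 ⊆ s.1 ∨ s.1 ⊆ z.1 := fun t ht z hz =>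
    mem_allFaces_barycentricSubdivision.1 ht.2 z (Finset.mem_union_right _ hz) s
      (Finset.mem_union_left _ hs)
  -- A face w between ρ and s that avoids v and differs from ρ is neither in C nor equal to x, so it
  -- may be added whenever it is comparable with t.
  have hins : ∀ t ∈ {t ∈ linkFamily Δ.barycentricSubdivision.allFaces C | x ∉ t},
      ∀ w : {σ // σ ∈ Δ.faces}, ρ ⊆ w.1 → w.1 ⊆ s.1 → w.1 ≠ ρ → v ∉ w.1 →
      (∀ z ∈ t, w.1 ⊆ z.1 ∨ z.1 ⊆ w.1) →
      insert w t ∈ {t ∈ linkFamily Δ.barycentricSubdivision.allFaces C | x ∉ t} := by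
    rintro t ⟨⟨hd, ht⟩, hxt⟩ w hρw hws hwρ hvw hcmp
    refine ⟨⟨Finset.disjoint_insert_right.2 ⟨fun hwC => ?_, hd⟩, ?_⟩, fun hxw => ?_⟩
    · rcases hgap w hwC with h | h
      · exact hwρ (h.antisymm hρw)
      · exact hvw (h hvs)
    · rw [Finset.union_insert]
      refine insert_mem_allFaces_barycentricSubdivision ht fun z hz => ?_
      rcases Finset.mem_union.1 hz with hz | hz
      · rcases hgap z hz with h | h
        · exact Or.inr (h.trans hρw)
        · exact Or.inl (hws.trans h)
      · exact hcmp z hz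
    · rcases Finset.mem_insert.1 hxw with rfl | h
      · exact hvw (hx ▸ Finset.mem_insert_self _ _)
      · exact hxt h
  -- The vertices y ≠ x strictly between ρ and s that contain v are removed, smaller ones first,
  -- each through a cone with apex y \ {v}; y ≠ x ensures that this apex is not ρ. Every remaining
  -- vertex within s then avoids v, so c = s \ {v} is a cone apex for what is left.
  rw [← acyclicAt_avoiding_set_iff (isLowerSet_del hL x) (fun τ => ∑ a ∈ τ, (a.1.card : ℤ))
    {τ | ∃ y : {σ // σ ∈ Δ.faces}, (v ∈ y.1 ∧ ρ ⊆ y.1 ∧ y.1 ⊆ s.1 ∧ y ≠ s ∧ y ≠ x) ∧ τ = {y}}]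
  · refine acyclicAt_of_cone c ?_ k
    rintro t ⟨ht, hT⟩
    refine ⟨?_, ?_⟩
    · refine hins t ht c (hc ▸ Finset.subset_erase.2 ⟨hρs, hvρ⟩) (hc ▸ Finset.erase_subset _ _) hρc
        (hc ▸ Finset.notMem_erase _ _) fun z hz => ?_
      rw [hc]
      rcases hcmps t ht.1 z hz with h | h
      · refine Or.inr (Finset.subset_erase.2 ⟨h, fun hvz => ?_⟩)
        refine hT {z} ⟨z, ⟨hvz, ?_, h, ?_, ?_⟩, rfl⟩ (Finset.singleton_subset_iff.2 hz)
        · exact (hcmpρ t ht.1 z hz).resolve_left fun h => hvρ (h hvz)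
        · rintro rfl
          exact Finset.disjoint_left.1 ht.1.1 hs hz
        · rintro rfl
          exact ht.2 hz
      · exact Or.inl ((Finset.erase_subset _ _).trans h)
    · rintro _ ⟨y, hy, rfl⟩ hyt
      rcases Finset.mem_insert.1 (Finset.singleton_subset_iff.1 hyt) with rfl | hyt
      · exact Finset.notMem_erase v s.1 (hc ▸ hy.1)
      · exact hT _ ⟨y, hy, rfl⟩ (Finset.singleton_subset_iff.2 hyt)
  · rintro _ ⟨y, ⟨hvy, hρy, hys, hyns, hyx⟩, rfl⟩
    have hne : y.1.erase v ≠ ρ := fun h =>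
      hyx (Subtype.ext (by rw [hx, ← h, Finset.insert_erase hvy]))
    have hρe : ρ ⊆ y.1.erase v := Finset.subset_erase.2 ⟨hρy, hvρ⟩
    have hw : y.1.erase v ∈ Δ.faces := (Δ.isRelLowerSet_faces y.2).2 (Finset.erase_subset _ _)
      (Finset.nonempty_iff_ne_empty.2 fun h => hne (h.trans (Finset.subset_empty.1 (h ▸ hρe)).symm))
    refine ⟨⟨_, hw⟩, fun h => ?_, fun t ht hyt hmin => ⟨?_, ?_⟩⟩
    · rw [Finset.mem_singleton, Subtype.ext_iff] at h
      exact Finset.notMem_erase v y.1 (h.symm.subset hvy)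
    · refine hins t ht _ hρe ((Finset.erase_subset _ _).trans hys) hne (Finset.notMem_erase _ _)
        fun z hz => ?_
      rw [Finset.singleton_subset_iff] at hyt
      rcases mem_allFaces_barycentricSubdivision.1 ht.1.2 y (Finset.mem_union_right _ hyt) z
        (Finset.mem_union_right _ hz) with h | h
      · exact Or.inl ((Finset.erase_subset _ _).trans h)
      · by_cases hvz : v ∈ z.1
        · have := hmin {z} ⟨z, ⟨hvz, (hcmpρ t ht.1 z hz).resolve_left fun h => hvρ (h hvz),
            h.trans hys, fun hzs => Finset.disjoint_left.1 ht.1.1 hs (hzs ▸ hz),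
            fun hzx => ht.2 (hzx ▸ hz)⟩, rfl⟩ (Finset.singleton_subset_iff.2 hz)
          simp only [Finset.sum_singleton, Nat.cast_le] at this
          rw [Finset.eq_of_subset_of_card_le h this]
          exact Or.inl (Finset.erase_subset _ _)
        · exact Or.inr (Finset.subset_erase.2 ⟨h, hvz⟩)
    · rintro _ ⟨z, hz, rfl⟩ hzt
      rcases Finset.mem_insert.1 (Finset.singleton_subset_iff.1 hzt) with rfl | hzt
      · exact absurd hz.1 (Finset.notMem_erase _ _)
      · exact Finset.singleton_subset_iff.2 hzt

variable (𝕜) in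
/-- A chain which is not saturated below its top member can be refined so that its link is a
homology suspension of the link of the refinement. -/
theorem exists_refinement {C : Finset {σ // σ ∈ Δ.faces}}
    (hC : C ∈ Δ.barycentricSubdivision.allFaces) {σ : {σ // σ ∈ Δ.faces}} (hσ : σ ∈ C)
    (htop : ∀ y ∈ C, y.1 ⊆ σ.1) (hcard : C.card < σ.1.card) :
    ∃ x, x ∉ C ∧ x.1 ⊆ σ.1 ∧ insert x C ∈ Δ.barycentricSubdivision.allFaces ∧
      ∀ k : ℕ,
        AcyclicAt 𝕜 k {t ∈ linkFamily Δ.barycentricSubdivision.allFaces C | x ∉ t} := by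
  obtain ⟨s, hs, ρ, hρ, hgap, hρs, hcard⟩ := exists_gap hC hσ hcard
  obtain ⟨v, hvs, hvρ⟩ := Finset.exists_mem_notMem_of_card_lt_card (s := ρ) (t := s.1) (by omega)
  have hxs : insert v ρ ⊆ s.1 := Finset.insert_subset hvs hρs
  have hxc : (insert v ρ).card = ρ.card + 1 := Finset.card_insert_of_notMem hvρ
  have hcc : (s.1.erase v).card + 1 = s.1.card := Finset.card_erase_add_one hvs
  have hx : insert v ρ ∈ Δ.faces :=
    (Δ.isRelLowerSet_faces s.2).2 hxs (Finset.insert_nonempty _ _)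
  have hc : s.1.erase v ∈ Δ.faces :=
    (Δ.isRelLowerSet_faces s.2).2 (Finset.erase_subset _ _) (Finset.card_pos.1 (by omega))
  refine ⟨⟨_, hx⟩, fun hxC => ?_, hxs.trans (htop s hs), ?_, fun k =>
    acyclicAt_del_of_gap (c := ⟨_, hc⟩) hs hρ hgap hρs hvs hvρ rfl rfl (fun h => ?_) k⟩
  · rcases hgap _ hxC with h | h
    · exact hvρ (h (Finset.mem_insert_self _ _))
    · have := Finset.card_le_card h
      simp only at this
      omega
  · refine insert_mem_allFaces_barycentricSubdivision hC fun b hb => ?_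
    rcases hgap b hb with h | h
    · exact Or.inr (h.trans (Finset.subset_insert _ _))
    · exact Or.inl (hxs.trans h)
  · simp only at h
    rw [h] at hcc
    omega

/-- The link of a nonempty chain of faces with top member `σ` is, up to homology, an iterated
suspension of the link of `σ`. -/
theorem acyclicAt_link_chain {C : Finset {σ // σ ∈ Δ.faces}}
    (hC : C ∈ Δ.barycentricSubdivision.allFaces) {σ : {σ // σ ∈ Δ.faces}} (hσ : σ ∈ C)
    (htop : ∀ y ∈ C, y.1 ⊆ σ.1) {n : ℕ} (hn : C.card + n = σ.1.card) :
    (∀ k, AcyclicAt 𝕜 (k + n) (linkFamily Δ.barycentricSubdivision.allFaces C) ↔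
      AcyclicAt 𝕜 k (linkFamily Δ.allFaces σ.1)) ∧
    ∀ j < n, AcyclicAt 𝕜 j (linkFamily Δ.barycentricSubdivision.allFaces C) := by
  induction n generalizing C with
  | zero =>
    refine ⟨fun k => ?_, fun j hj => absurd hj (Nat.not_lt_zero _)⟩
    rw [linkFamily_eq_upperChains hC hσ htop hn]
    exact acyclicAt_upperChains_iff (Or.inr σ.2) k
  | succ n ih =>
    obtain ⟨x, hxC, hxσ, hxf, hdel⟩ := exists_refinement 𝕜 hC hσ htop (by omega)
    obtain ⟨ih1, ih2⟩ := ih hxf (Finset.mem_insert_of_mem hσ)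
      (fun y hy => (Finset.mem_insert.1 hy).elim (fun h => h ▸ hxσ) (htop y))
      (by rw [Finset.card_insert_of_notMem hxC]; omega)
    have hL := isLowerSet_linkFamily (isLowerSet_allFaces Δ.barycentricSubdivision) C
    have hsus := acyclicAt_succ_iff_link hL x hdel
    rw [linkFamily_linkFamily_singleton C hxC] at hsus
    refine ⟨fun k => (hsus (k + n)).trans (ih1 k), fun j hj => ?_⟩
    cases j with
    | zero => exact acyclicAt_zero_of_del hL x (hdel 0)
    | succ j => exact (hsus j).2 (ih2 j (by omega))

/-- The link of the empty chain. -/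
theorem acyclicAt_link_empty (k : ℕ) :
    AcyclicAt 𝕜 k (linkFamily Δ.barycentricSubdivision.allFaces ∅) ↔
      AcyclicAt 𝕜 k (linkFamily Δ.allFaces ∅) := by
  have h : linkFamily Δ.barycentricSubdivision.allFaces ∅ = upperChains Δ ∅ := by
    ext t
    simp only [linkFamily, upperChains, Set.mem_ofPred_eq, Finset.disjoint_empty_left, true_and,
      Finset.empty_union]
    exact ⟨fun h => ⟨h, fun y _ => Finset.empty_ssubset.2 (nonempty_of_mem_faces y.2)⟩,
      fun h => h.1⟩
  rw [h]
  exact acyclicAt_upperChains_iff (Or.inl rfl) k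

theorem exists_chain_of_card (σ : {σ // σ ∈ Δ.faces}) {r : ℕ} (hr : 1 ≤ r) (hrσ : r ≤ σ.1.card) :
    ∃ C ∈ Δ.barycentricSubdivision.allFaces, σ ∈ C ∧ (∀ y ∈ C, y.1 ⊆ σ.1) ∧ C.card = r := by
  induction r, hr using Nat.le_induction with
  | base =>
    refine ⟨{σ}, mem_allFaces_barycentricSubdivision.2 ?_, Finset.mem_singleton_self _, ?_,
      Finset.card_singleton _⟩
    · simp
    · simp
  | succ r hr ih =>
    obtain ⟨C, hC, hσ, htop, hcard⟩ := ih (by omega)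
    -- Only the combinatorial part of the refinement is used, so any field would do.
    obtain ⟨x, hxC, hxσ, hxf, -⟩ := exists_refinement ℚ hC hσ htop (by omega)
    exact ⟨insert x C, hxf, Finset.mem_insert_of_mem hσ,
      fun y hy => (Finset.mem_insert.1 hy).elim (fun h => h ▸ hxσ) (htop y),
      by rw [Finset.card_insert_of_notMem hxC, hcard]⟩

end OrderedChains

/-! The equivalence of the PR and Cohen–Macaulay conditions. -/

namespace OrderedChains

open PreAbstractSimplicialComplex

variable {V : Type*} (𝕜 : Type*) [Field 𝕜] {Δ : PreAbstractSimplicialComplex V}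

variable (Δ) in
theorem exists_card_eq_dim [Finite V] : ∃ D : ℕ, Δ.dim = D - 1 ∧ (∃ F ∈ Δ.allFaces, F.card = D) ∧
    ∀ σ ∈ Δ.allFaces, σ.card ≤ D := by
  have hfin : (Finset.card '' Δ.allFaces).Finite := (Set.toFinite _).image _
  have hne : (Finset.card '' Δ.allFaces).Nonempty := ⟨_, ∅, Or.inl rfl, rfl⟩
  exact ⟨_, rfl, Nat.sSup_mem hne hfin.bddAbove,
    fun σ hσ => le_csSup hfin.bddAbove (Set.mem_image_of_mem _ hσ)⟩

variable [DecidableEq V]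

variable {𝕜} in
theorem hasReducedHomology_link_iff {σ : Finset V} (hσ : σ ∈ Δ.allFaces) (i : ℤ) :
    (Δ.link σ).HasReducedHomology 𝕜 i ↔
      ∃ k : ℕ, (k : ℤ) = i + 1 ∧ ¬ AcyclicAt 𝕜 k (linkFamily Δ.allFaces σ) := by
  rw [hasReducedHomology_iff, allFaces_link hσ]

variable {𝕜} in
theorem hasReducedHomology_link_natCast {σ : Finset V} (hσ : σ ∈ Δ.allFaces) (k : ℕ) :
    (Δ.link σ).HasReducedHomology 𝕜 ((k : ℤ) - 1) ↔
      ¬ AcyclicAt 𝕜 k (linkFamily Δ.allFaces σ) := by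
  rw [hasReducedHomology_link_iff hσ]
  constructor
  · rintro ⟨l, hl, h⟩
    obtain rfl : l = k := by omega
    exact h
  · exact fun h => ⟨k, by omega, h⟩

theorem linkFamily_eq_singleton_of_card {D : ℕ} (hmax : ∀ σ ∈ Δ.allFaces, σ.card ≤ D)
    {F : Finset V} (hF : F ∈ Δ.allFaces) (hFD : F.card = D) :
    linkFamily Δ.allFaces F = {∅} := by
  ext τ
  rw [Set.mem_singleton_iff]
  constructor
  · rintro ⟨hd, h⟩
    have := hmax _ h
    rw [Finset.card_union_of_disjoint hd] at this
    exact Finset.card_eq_zero.1 (by omega)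
  · rintro rfl
    exact ⟨Finset.disjoint_empty_right _, by rwa [Finset.union_empty]⟩

theorem isPR_iff : Δ.IsPR 𝕜 ↔ ∀ k : ℕ, ∀ σ ∈ Δ.allFaces, ∀ τ ∈ Δ.allFaces,
    ¬ AcyclicAt 𝕜 k (linkFamily Δ.allFaces σ) → ¬ AcyclicAt 𝕜 k (linkFamily Δ.allFaces τ) →
      σ.card = τ.card := by
  constructor
  · intro h k σ hσ τ hτ h1 h2
    exact h (k - 1) σ hσ τ hτ ((hasReducedHomology_link_natCast hσ k).2 h1)
      ((hasReducedHomology_link_natCast hτ k).2 h2)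
  · intro h i σ hσ τ hτ h1 h2
    obtain ⟨k, hk, h1⟩ := (hasReducedHomology_link_iff hσ i).1 h1
    obtain ⟨l, hl, h2⟩ := (hasReducedHomology_link_iff hτ i).1 h2
    obtain rfl : l = k := by omega
    exact h l σ hσ τ hτ h1 h2

theorem isCohenMacaulay_iff {D : ℕ} (hD : Δ.dim = D - 1) : Δ.IsCohenMacaulay 𝕜 ↔
    ∀ σ ∈ Δ.allFaces, ∀ k : ℕ, ¬ AcyclicAt 𝕜 k (linkFamily Δ.allFaces σ) → k + σ.card = D := by
  constructor
  · intro h σ hσ k hk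
    by_contra hne
    exact h σ hσ (k - 1) (by omega) ((hasReducedHomology_link_natCast hσ k).2 hk)
  · intro h σ hσ i hi hh
    obtain ⟨k, hk, hh⟩ := (hasReducedHomology_link_iff hσ i).1 hh
    have := h σ hσ k hh
    omega

variable [Finite V]

theorem add_card_le_of_not_acyclicAt {D : ℕ} (hmax : ∀ σ ∈ Δ.allFaces, σ.card ≤ D)
    {σ : Finset V} {k : ℕ} (hk : ¬ AcyclicAt 𝕜 k (linkFamily Δ.allFaces σ)) :
    k + σ.card ≤ D := by
  by_contra hlt
  refine hk (acyclicAt_of_card_lt (isLowerSet_linkFamily (isLowerSet_allFaces Δ) σ)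
    fun ρ hρ => ?_)
  have := hmax _ hρ.2
  rw [Finset.card_union_of_disjoint hρ.1] at this
  omega

/-- Homology of link σ with k entries forces |σ| = D - k, which gives PR and s_k = D - k. It also
makes this homology top-dimensional in the link, so it descends to the link of a vertex with k
lowered by one; hence the degrees that occur form an initial segment. -/
theorem IsCohenMacaulay.isPRWithDegreeTypeOnes (h : Δ.IsCohenMacaulay 𝕜) :
    Δ.IsPRWithDegreeTypeOnes 𝕜 := by
  obtain ⟨D, hD, ⟨F, hF, hFD⟩, hmax⟩ := exists_card_eq_dim Δ
  rw [isCohenMacaulay_iff 𝕜 hD] at h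
  have hdown : ∀ k : ℕ, ∀ σ ∈ Δ.allFaces,
      ¬ AcyclicAt 𝕜 (k + 1) (linkFamily Δ.allFaces σ) →
      ∃ τ ∈ Δ.allFaces, ¬ AcyclicAt 𝕜 k (linkFamily Δ.allFaces τ) := by
    intro k σ hσ hk
    have hkD := h σ hσ _ hk
    obtain ⟨x, hx, hxk⟩ := exists_not_acyclicAt_link
      (isLowerSet_linkFamily (isLowerSet_allFaces Δ) σ) (fun ρ hρ => by
        have := hmax _ hρ.2
        rw [Finset.card_union_of_disjoint hρ.1] at this
        omega) hk
    rw [linkFamily_linkFamily_singleton σ (Finset.disjoint_singleton_right.1 hx.1)] at hxk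
    refine ⟨insert x σ, ?_, hxk⟩
    have := hx.2
    rwa [Finset.union_comm, ← Finset.insert_eq] at this
  set S : Set ℕ := {k | ∃ σ ∈ Δ.allFaces, ¬ AcyclicAt 𝕜 k (linkFamily Δ.allFaces σ)} with hS
  have hSne : S.Nonempty := ⟨0, F, hF, not_acyclicAt_zero_of_eq_singleton
    (linkFamily_eq_singleton_of_card hmax hF hFD)⟩
  have hSb : BddAbove S := ⟨D, by
    rintro k ⟨σ, hσ, hk⟩
    have := h σ hσ k hk
    omega⟩
  have hp : sSup S ∈ S := Nat.sSup_mem hSne hSb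
  have hall : ∀ k ≤ sSup S, k ∈ S := fun k hk => by
    induction hk using Nat.decreasingInduction with
    | self => exact hp
    | of_succ k _ ih =>
      obtain ⟨σ, hσ, hk⟩ := ih
      exact hdown k σ hσ hk
  -- The truncated subtraction is harmless, since i ≤ `sSup S` ≤ D in every index that matters.
  refine ⟨sSup S, ?_, ?_, fun i => D - i, ?_, ?_⟩
  · rw [isPR_iff]
    intro k σ hσ τ hτ h1 h2
    have := h σ hσ k h1
    have := h τ hτ k h2
    omega
  · intro σ hσ i hi
    obtain ⟨k, hk, hi⟩ := (hasReducedHomology_link_iff hσ i).1 hi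
    have : k ≤ sSup S := le_csSup hSb ⟨σ, hσ, hi⟩
    omega
  · intro i hi
    obtain ⟨σ, hσ, hk⟩ := hall i hi
    have := h σ hσ i hk
    exact ⟨σ, hσ, by simp only; omega, (hasReducedHomology_link_natCast hσ i).2 hk⟩
  · intro i
    obtain ⟨σ, hσ, hk⟩ := hp
    have := h σ hσ _ hk
    have := i.2
    simp only
    omega

/-- A face of maximal size D has link {∅}, so s_0 = D; the unit steps then give s_k = D - k. -/
theorem IsPRWithDegreeTypeOnes.isCohenMacaulay (h : Δ.IsPRWithDegreeTypeOnes 𝕜) :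
    Δ.IsCohenMacaulay 𝕜 := by
  obtain ⟨D, hD, ⟨F, hF, hFD⟩, hmax⟩ := exists_card_eq_dim Δ
  obtain ⟨p, hPR, hp, s, hs, hd⟩ := h
  rw [isPR_iff] at hPR
  have hs' : ∀ k ≤ p, ∀ σ ∈ Δ.allFaces, ¬ AcyclicAt 𝕜 k (linkFamily Δ.allFaces σ) →
      σ.card = s k := by
    intro k hk σ hσ h
    obtain ⟨τ, hτ, hτs, hτk⟩ := hs k hk
    rw [← hτs]
    exact hPR k σ hσ τ hτ h ((hasReducedHomology_link_natCast hτ k).1 hτk)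
  have hsD : ∀ k ≤ p, s k + k = D := by
    intro k
    induction k with
    | zero =>
      intro hk
      rw [← hs' 0 hk F hF (not_acyclicAt_zero_of_eq_singleton
        (linkFamily_eq_singleton_of_card hmax hF hFD)), hFD, add_zero]
    | succ k ih =>
      intro hk
      have h1 := ih (by omega)
      have h2 := hd ⟨k, hk⟩
      simp only at h2
      omega
  rw [isCohenMacaulay_iff 𝕜 hD]
  intro σ hσ k hk
  have hkp : k ≤ p := by
    have := hp σ hσ _ ((hasReducedHomology_link_natCast hσ k).2 hk)
    omega
  rw [hs' k hkp σ hσ hk, add_comm]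
  exact hsD k hkp

variable (Δ) in
-- A chain has at most as many members as its top has elements, and a face of maximal size is the
-- top of a chain attaining this bound.
theorem dim_barycentricSubdivision : Δ.barycentricSubdivision.dim = Δ.dim := by
  obtain ⟨D, hD, ⟨F, hF, hFD⟩, hmax⟩ := exists_card_eq_dim Δ
  obtain ⟨E, hE, ⟨C, hC, hCE⟩, hmaxB⟩ := exists_card_eq_dim Δ.barycentricSubdivision
  have h1 : E ≤ D := by
    rcases C.eq_empty_or_nonempty with rfl | hne
    · simp [← hCE]
    · obtain ⟨σ, -, htop⟩ := exists_top_of_mem_allFaces hC hne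
      exact hCE ▸ (card_chain_le hC htop).trans (hmax _ (Or.inr σ.2))
  have h2 : D ≤ E := by
    rcases F.eq_empty_or_nonempty with rfl | hne
    · simp [← hFD]
    · obtain ⟨C, hC, -, -, hCD⟩ := exists_chain_of_card
        ⟨F, mem_faces_of_mem_allFaces hF hne⟩ hne.card_pos le_rfl
      exact hFD ▸ hCD ▸ hmaxB C hC
  rw [hD, hE, le_antisymm h1 h2]

/-- Homology of link C can only occur at k = j + n with link σ having homology at j, so j + |σ| = D
and |C| + n = |σ| add up to k + |C| = D. -/
theorem IsCohenMacaulay.barycentricSubdivision (h : Δ.IsCohenMacaulay 𝕜) :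
    Δ.barycentricSubdivision.IsCohenMacaulay 𝕜 := by
  obtain ⟨D, hD, -⟩ := exists_card_eq_dim Δ
  rw [isCohenMacaulay_iff 𝕜 hD] at h
  rw [isCohenMacaulay_iff 𝕜 ((dim_barycentricSubdivision Δ).trans hD)]
  intro C hC k hk
  rcases C.eq_empty_or_nonempty with rfl | hne
  · rw [acyclicAt_link_empty] at hk
    simpa using h ∅ (Or.inl rfl) k hk
  · obtain ⟨σ, hσ, htop⟩ := exists_top_of_mem_allFaces hC hne
    obtain ⟨n, hn⟩ := Nat.exists_eq_add_of_le (card_chain_le hC htop)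
    obtain ⟨h1, h2⟩ := acyclicAt_link_chain (𝕜 := 𝕜) hC hσ htop hn.symm
    have hnk : n ≤ k := by
      by_contra hlt
      exact hk (h2 k (by omega))
    obtain ⟨j, rfl⟩ := Nat.exists_eq_add_of_le' hnk
    have := h σ.1 (Or.inr σ.2) j (fun hj => hk ((h1 j).2 hj))
    omega

theorem IsPR.isCohenMacaulay_of_barycentricSubdivision
    (h : Δ.barycentricSubdivision.IsPR 𝕜) : Δ.IsCohenMacaulay 𝕜 := by
  obtain ⟨D, hD, ⟨F, hF, hFD⟩, hmax⟩ := exists_card_eq_dim Δ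
  rw [isPR_iff] at h
  rw [isCohenMacaulay_iff 𝕜 hD]
  -- Reference chains: with top F and size D - k, the link is a k-fold homology suspension of {∅}.
  have hFne : ∀ k < D, ∃ C ∈ Δ.barycentricSubdivision.allFaces, C.card + k = D ∧
      ¬ AcyclicAt 𝕜 k (linkFamily Δ.barycentricSubdivision.allFaces C) := by
    intro k hk
    have hF' : F ∈ Δ.faces := mem_faces_of_mem_allFaces hF (Finset.card_pos.1 (by omega))
    obtain ⟨C, hC, hFC, htop, hCk⟩ := exists_chain_of_card ⟨F, hF'⟩ (r := D - k) (by omega)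
      (by simp only; omega)
    refine ⟨C, hC, by omega, ?_⟩
    have := (acyclicAt_link_chain (𝕜 := 𝕜) (n := k) hC hFC htop (by simp only; omega)).1 0
    rw [zero_add] at this
    rw [this]
    exact not_acyclicAt_zero_of_eq_singleton (linkFamily_eq_singleton_of_card hmax hF hFD)
  intro σ hσ k hk
  have hle := add_card_le_of_not_acyclicAt 𝕜 hmax hk
  by_contra hne
  rcases σ.eq_empty_or_nonempty with rfl | hnonempty
  · rw [Finset.card_empty] at hle hne
    obtain ⟨C, hC, hCk, hCh⟩ := hFne k (by omega)
    have := h k ∅ (Or.inl rfl) C hC (by rwa [acyclicAt_link_empty]) hCh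
    rw [Finset.card_empty] at this
    omega
  · have hpos := hnonempty.card_pos
    obtain ⟨E, hE, hσE, htop, hEc⟩ := exists_chain_of_card
      ⟨σ, mem_faces_of_mem_allFaces hσ hnonempty⟩ (r := 1) le_rfl hpos
    have hEk := (acyclicAt_link_chain (𝕜 := 𝕜) (n := σ.card - 1) hE hσE htop
      (by simp only; omega)).1 k
    -- The one-element chain {σ} has homology at this index, so PR forces the reference chain to
    -- have size 1, which says k + |σ| = D.
    obtain ⟨C, hC, hCk, hCh⟩ := hFne (k + (σ.card - 1)) (by omega)
    have := h _ E hE C hC (fun h => hk (hEk.1 h)) hCh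
    omega

end OrderedChains

theorem mainTheorem6 {V : Type*} [Finite V] [DecidableEq V] (𝕜 : Type*) [Field 𝕜]
    (Δ : PreAbstractSimplicialComplex V) :
    List.TFAE
      [Δ.barycentricSubdivision.IsPR 𝕜,
       Δ.barycentricSubdivision.IsCohenMacaulay 𝕜,
       Δ.barycentricSubdivision.IsPRWithDegreeTypeOnes 𝕜,
       Δ.IsCohenMacaulay 𝕜,
       Δ.IsPRWithDegreeTypeOnes 𝕜] := by
  tfae_have 1 → 4 := OrderedChains.IsPR.isCohenMacaulay_of_barycentricSubdivision 𝕜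
  tfae_have 4 → 2 := OrderedChains.IsCohenMacaulay.barycentricSubdivision 𝕜
  tfae_have 2 → 3 := OrderedChains.IsCohenMacaulay.isPRWithDegreeTypeOnes 𝕜
  tfae_have 3 → 1 := fun ⟨_, h⟩ => h.1
  tfae_have 4 → 5 := OrderedChains.IsCohenMacaulay.isPRWithDegreeTypeOnes 𝕜
  tfae_have 5 → 4 := OrderedChains.IsPRWithDegreeTypeOnes.isCohenMacaulay 𝕜
  tfae_finish
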